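/- For an integer $r \ge 2$ let $$\mathbb{L}_r = \mathbb{Z}\langle x_1,\dots,x_r,y_1,\dots,y_r \mid x_s y_t = \delta_{s,t}\ (1\le s,t\le r),\ \textstyle\sum_{s=1}^r y_s x_s = 1\rangle$$ be the Leavitt ring. It carries the involution $p \mapsto p^*$ which is the unique anti-automorphism interchanging $x_s$ and $y_s$ for every $s$, and the partial order whose positive cone (the set of elements $\ge 0$) is the additive monoid generated by all monomials, i.e. all products of elements of $\{x_1,\dots,x_r,y_1,\dots,y_r\}$. The ring $M_m(\mathbb{L}_r)$ of $m\times m$ matrices carries the conjugate-transpose involution and the partial order whose positive cone is the additive monoid generated by the matrices $p\,e_{i,j}$, where $p \ge 0$ in $\mathbb{L}_r$ and $e_{i,j}$ is a matrix unit; both are partially ordered rings with involution. **Theorem (Abrams–Ánh–Pardo).** Let $r \ge 3$ and $m \ge r+1$ be integers with $\gcd(m, r-1) = 1$. Then $\mathbb{L}_r$ and $M_m(\mathbb{L}_r)$ are isomorphic as partially ordered rings with involution: there is a ring isomorphism $\varphi\colon \mathbb{L}_r \to M_m(\mathbb{L}_r)$ such that $\varphi(a^*) = \varphi(a)^*$ for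 all $a$, and $\varphi(a) \le \varphi(b)$ if and only if $a \le b$, for all $a, b$. -/

import Mathlib

namespace Leavitt

/-- The symbols `x_s` and `y_s`, with `s` in a set of `r` indices. -/
inductive Gen (r : ℕ) : Type
  | x (s : Fin r) : Gen r
  | y (s : Fin r) : Gen r

/-- The defining relations of the Leavitt ring: `x_s y_t = δ_{s,t}` and `∑ s, y_s x_s = 1`. -/
inductive Rel (r : ℕ) : FreeAlgebra ℤ (Gen r) → FreeAlgebra ℤ (Gen r) → Prop
  | x_mul_y (s t : Fin r) :
      Rel r (FreeAlgebra.ι ℤ (Gen.x s) * FreeAlgebra.ι ℤ (Gen.y t)) (if s = t then 1 else 0)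
  | sum_y_mul_x :
      Rel r (∑ s : Fin r, FreeAlgebra.ι ℤ (Gen.y s) * FreeAlgebra.ι ℤ (Gen.x s)) 1

end Leavitt

/-- The Leavitt ring `𝕃_r = ℤ⟨x_1, …, x_r, y_1, …, y_r | x_s y_t = δ_{s,t}, ∑ s, y_s x_s = 1⟩`. -/
def Leavitt (r : ℕ) : Type := RingQuot (Leavitt.Rel r)

namespace Leavitt

noncomputable instance (r : ℕ) : Ring (Leavitt r) := inferInstanceAs (Ring (RingQuot (Rel r)))

/-- The quotient map from the free ring. -/
noncomputable def mk (r : ℕ) : FreeAlgebra ℤ (Gen r) →+* Leavitt r := RingQuot.mkRingHom (Rel r)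

/-- The generators `x_s` of the Leavitt ring. -/
noncomputable def x {r : ℕ} (s : Fin r) : Leavitt r := mk r (FreeAlgebra.ι ℤ (Gen.x s))

/-- The generators `y_s` of the Leavitt ring. -/
noncomputable def y {r : ℕ} (s : Fin r) : Leavitt r := mk r (FreeAlgebra.ι ℤ (Gen.y s))

theorem x_mul_y {r : ℕ} (s t : Fin r) : (x s * y t : Leavitt r) = if s = t then 1 else 0 := by
  have h := RingQuot.mkRingHom_rel (Rel.x_mul_y s t)
  rw [map_mul] at h
  refine h.trans ?_
  split_ifs
  · exact map_one (mk r)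
  · exact map_zero (mk r)

theorem sum_y_mul_x (r : ℕ) : (∑ s : Fin r, y s * x s : Leavitt r) = 1 := by
  have h := RingQuot.mkRingHom_rel (Rel.sum_y_mul_x (r := r))
  rw [map_sum, map_one] at h
  simp only [map_mul] at h
  exact h

/-- The universal property of the Leavitt ring. -/
noncomputable def lift {r : ℕ} {A : Type*} [Ring A] (f : Gen r → A)
    (hxy : ∀ s t, f (Gen.x s) * f (Gen.y t) = if s = t then 1 else 0)
    (hyx : ∑ s, f (Gen.y s) * f (Gen.x s) = 1) : Leavitt r →+* A :=
  RingQuot.lift ⟨((FreeAlgebra.lift ℤ f : FreeAlgebra ℤ (Gen r) →ₐ[ℤ] A) :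
      FreeAlgebra ℤ (Gen r) →+* A), by
    rintro _ _ (⟨s, t⟩ | _)
    · simp only [RingHom.coe_coe, map_mul, FreeAlgebra.lift_ι_apply, hxy]
      split_ifs <;> simp
    · simpa using hyx⟩

section lift

variable {r : ℕ} {A : Type*} [Ring A] (f : Gen r → A)
    (hxy : ∀ s t, f (Gen.x s) * f (Gen.y t) = if s = t then 1 else 0)
    (hyx : ∑ s, f (Gen.y s) * f (Gen.x s) = 1)

theorem lift_x (s : Fin r) : lift f hxy hyx (x s) = f (Gen.x s) := by
  refine (RingQuot.lift_mkRingHom_apply _ _ _).trans ?_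
  simp

theorem lift_y (s : Fin r) : lift f hxy hyx (y s) = f (Gen.y s) := by
  refine (RingQuot.lift_mkRingHom_apply _ _ _).trans ?_
  simp

end lift

theorem induction {r : ℕ} {P : Leavitt r → Prop} (hz : ∀ n : ℤ, P n)
    (hx : ∀ s, P (x s)) (hy : ∀ s, P (y s)) (hmul : ∀ a b, P a → P b → P (a * b))
    (hadd : ∀ a b, P a → P b → P (a + b)) (a : Leavitt r) : P a := by
  obtain ⟨b, rfl⟩ := RingQuot.mkRingHom_surjective (Rel r) a
  change P (mk r b)
  induction b using FreeAlgebra.induction with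
  | grade0 n => simpa using hz n
  | grade1 z =>
    cases z with
    | x s => exact hx s
    | y s => exact hy s
  | mul a b ha hb => rw [map_mul]; exact hmul _ _ ha hb
  | add a b ha hb => rw [map_add]; exact hadd _ _ ha hb

/-- The involution as a ring homomorphism to the opposite ring. -/
noncomputable def starHom (r : ℕ) : Leavitt r →+* (Leavitt r)ᵐᵒᵖ :=
  lift (fun z => MulOpposite.op (match z with
    | Gen.x s => y s
    | Gen.y s => x s))
    (fun s t => by
      simp only [← MulOpposite.op_mul, x_mul_y, eq_comm (a := t)]
      split_ifs <;> simp)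
    (by
      simp only [← MulOpposite.op_mul]
      rw [← Finset.op_sum, sum_y_mul_x, MulOpposite.op_one])

theorem starHom_x {r : ℕ} (s : Fin r) : starHom r (x s) = MulOpposite.op (y s) :=
  lift_x _ _ _ s

theorem starHom_y {r : ℕ} (s : Fin r) : starHom r (y s) = MulOpposite.op (x s) :=
  lift_y _ _ _ s

/-- The involution: the unique anti-automorphism that interchanges `x_s` and `y_s`. -/
noncomputable instance (r : ℕ) : StarRing (Leavitt r) where
  star a := (starHom r a).unop
  star_involutive a := by
    induction a using induction with
    | hz n => simp
    | hx s => simp [starHom_x, starHom_y]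
    | hy s => simp [starHom_x, starHom_y]
    | hmul a b ha hb => simp only [map_mul, MulOpposite.unop_mul, ha, hb]
    | hadd a b ha hb => simp only [map_add, MulOpposite.unop_add, ha, hb]
  star_mul a b := by simp
  star_add a b := by simp

theorem star_x {r : ℕ} (s : Fin r) : star (x s : Leavitt r) = y s :=
  congrArg MulOpposite.unop (starHom_x s)

theorem star_y {r : ℕ} (s : Fin r) : star (y s : Leavitt r) = x s :=
  congrArg MulOpposite.unop (starHom_y s)

/-- The multiplicative monoid of monomials: all products of generators `x_s`, `y_s`. -/
noncomputable def monomials (r : ℕ) : Submonoid (Leavitt r) :=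
  Submonoid.closure (Set.range x ∪ Set.range y)

/-- Every monomial is zero or of the form `y_u x_v`. -/
theorem eq_zero_or_exists_of_mem_monomials {r : ℕ} {a : Leavitt r} (ha : a ∈ monomials r) :
    a = 0 ∨ ∃ u v : List (Fin r), a = (u.map y).prod * (v.map x).prod := by
  induction ha using Submonoid.closure_induction_left with
  | one => exact .inr ⟨[], [], by simp⟩
  | mul_left z hz b hb ih =>
    rcases ih with rfl | ⟨u, v, rfl⟩
    · exact .inl (mul_zero _)
    rcases hz with ⟨s, rfl⟩ | ⟨s, rfl⟩
    · cases u with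
      | nil => exact .inr ⟨[], s :: v, by simp⟩
      | cons t u =>
        by_cases h : s = t
        · exact .inr ⟨u, v, by simp [← mul_assoc, x_mul_y, h]⟩
        · exact .inl (by simp [← mul_assoc, x_mul_y, h])
    · exact .inr ⟨s :: u, v, by simp [mul_assoc]⟩

theorem star_mem_monomials {r : ℕ} {a : Leavitt r} (ha : a ∈ monomials r) :
    star a ∈ monomials r := by
  induction ha using Submonoid.closure_induction with
  | mem z hz =>
    rcases hz with ⟨s, rfl⟩ | ⟨s, rfl⟩
    · rw [star_x]; exact Submonoid.subset_closure (.inr ⟨s, rfl⟩)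
    · rw [star_y]; exact Submonoid.subset_closure (.inl ⟨s, rfl⟩)
  | one => rw [star_one]; exact one_mem _
  | mul a b _ _ ha hb => rw [star_mul]; exact mul_mem hb ha

section order

/-- A representation on integer sequences, used only to see that a sum of nonzero monomials is
nonzero. -/
noncomputable def rep (r : ℕ) [NeZero r] : Leavitt r →+* Module.End ℤ (ℕ → ℤ) :=
  lift (fun z => match z with
    | Gen.x s => LinearMap.funLeft ℤ ℤ fun n => r * n + s
    | Gen.y s => LinearMap.pi fun n => if n % r = s then LinearMap.proj (n / r) else 0)
    (fun s t => by
      have hr : 0 < r := Nat.pos_of_neZero r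
      ext f n
      have h1 : (r * n + s) % r = s := by simp [Nat.mod_eq_of_lt s.2]
      have h2 : (r * n + s) / r = n := by
        rw [Nat.mul_add_div hr, Nat.div_eq_of_lt s.2, add_zero]
      by_cases h : s = t
      · subst h
        simp [h1, h2, LinearMap.funLeft_apply]
      · have h' : (s : ℕ) ≠ t := fun h' => h (Fin.ext h')
        simp [h1, h, h', LinearMap.funLeft_apply])
    (by
      have hr : 0 < r := Nat.pos_of_neZero r
      refine LinearMap.ext fun f => funext fun n => ?_
      rw [LinearMap.sum_apply, Finset.sum_apply,
        Finset.sum_eq_single (⟨n % r, Nat.mod_lt n hr⟩ : Fin r)]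
      · simp [LinearMap.funLeft_apply, Nat.div_add_mod]
      · intro b _ hb
        have h' : n % r ≠ (b : ℕ) := fun h' => hb (Fin.ext h'.symm)
        simp [h']
      · simp)

theorem rep_x {r : ℕ} [NeZero r] (s : Fin r) (f : ℕ → ℤ) (n : ℕ) :
    rep r (x s) f n = f (r * n + s) := by
  rw [rep, lift_x]
  rfl

theorem rep_y {r : ℕ} [NeZero r] (s : Fin r) (f : ℕ → ℤ) (n : ℕ) :
    rep r (y s) f n = if n % r = s then f (n / r) else 0 := by
  rw [rep, lift_y]
  by_cases h : n % r = s <;> simp [h]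

theorem rep_x_prod {r : ℕ} [NeZero r] (v : List (Fin r)) :
    rep r (v.map x).prod 1 = 1 := by
  induction v with
  | nil => simp
  | cons s v ih =>
    rw [List.map_cons, List.prod_cons, map_mul, Module.End.mul_apply, ih]
    ext n
    simp [rep_x]

theorem rep_y_prod {r : ℕ} [NeZero r] (u : List (Fin r)) :
    0 ≤ rep r (u.map y).prod 1 ∧ ∃ n, rep r (u.map y).prod 1 n ≠ 0 := by
  induction u with
  | nil => simp
  | cons s u ih =>
    obtain ⟨h0, n, hn⟩ := ih
    rw [List.map_cons, List.prod_cons, map_mul, Module.End.mul_apply]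
    refine ⟨fun k => ?_, r * n + s, ?_⟩
    · rw [rep_y]
      split_ifs
      · exact h0 _
      · exact le_rfl
    · have h2 : (r * n + s) / r = n := by
        rw [Nat.mul_add_div (Nat.pos_of_neZero r), Nat.div_eq_of_lt s.2, add_zero]
      rw [rep_y, h2, if_pos (by simp [Nat.mod_eq_of_lt s.2])]
      exact hn

theorem rep_nonneg {r : ℕ} [NeZero r] {a : Leavitt r}
    (ha : a ∈ AddSubmonoid.closure (monomials r : Set (Leavitt r))) :
    0 ≤ rep r a 1 ∧ (rep r a 1 = 0 → a = 0) := by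
  induction ha using AddSubmonoid.closure_induction with
  | mem a ha =>
    rcases eq_zero_or_exists_of_mem_monomials ha with rfl | ⟨u, v, rfl⟩
    · simp
    · rw [map_mul, Module.End.mul_apply, rep_x_prod]
      obtain ⟨h0, n, hn⟩ := rep_y_prod u
      exact ⟨h0, fun h => absurd (congrFun h n) hn⟩
  | zero => simp
  | add a b _ _ ha hb =>
    rw [map_add, LinearMap.add_apply]
    refine ⟨add_nonneg ha.1 hb.1, fun h => ?_⟩
    rw [add_eq_zero_iff_of_nonneg ha.1 hb.1] at h
    rw [ha.2 h.1, hb.2 h.2, add_zero]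

end order

/-- The positive cone of the Leavitt ring: the additive monoid generated by the monomials. -/
noncomputable def cone (r : ℕ) : RingCone (Leavitt r) where
  toAddSubmonoid := AddSubmonoid.closure (monomials r : Set (Leavitt r))
  one_mem' := AddSubmonoid.subset_closure (one_mem (monomials r))
  mul_mem' {a b} ha hb := by
    change a ∈ AddSubmonoid.closure (monomials r : Set (Leavitt r)) at ha
    change b ∈ AddSubmonoid.closure (monomials r : Set (Leavitt r)) at hb
    change a * b ∈ AddSubmonoid.closure (monomials r : Set (Leavitt r))
    exact (monomials r).subsemiringClosure.mul_mem ha hb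
  eq_zero_of_mem_of_neg_mem' {a} ha hna := by
    rcases Nat.eq_zero_or_pos r with rfl | hr
    · have h : (1 : Leavitt 0) = 0 := by rw [← sum_y_mul_x]; simp
      rw [← mul_one a, h, mul_zero]
    · have : NeZero r := ⟨hr.ne'⟩
      have h1 := rep_nonneg ha
      have h2 := rep_nonneg hna
      rw [map_neg, LinearMap.neg_apply, Left.nonneg_neg_iff] at h2
      exact h1.2 (le_antisymm h2.1 h1.1)

/-- The partial order on the Leavitt ring: `a ≤ b` if and only if `b - a` is in the cone. -/
noncomputable instance (r : ℕ) : PartialOrder (Leavitt r) := .mkOfAddGroupCone (cone r)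

instance (r : ℕ) : IsOrderedRing (Leavitt r) := .mkOfCone (cone r)

theorem nonneg_iff {r : ℕ} {a : Leavitt r} :
    0 ≤ a ↔ a ∈ AddSubmonoid.closure (monomials r : Set (Leavitt r)) := by
  change a - 0 ∈ AddSubmonoid.closure (monomials r : Set (Leavitt r)) ↔ _
  rw [sub_zero]

theorem star_nonneg_of_nonneg {r : ℕ} {a : Leavitt r} (ha : 0 ≤ a) : 0 ≤ star a := by
  rw [nonneg_iff] at ha
  induction ha using AddSubmonoid.closure_induction with
  | mem a ha => exact nonneg_iff.2 (AddSubmonoid.subset_closure (star_mem_monomials ha))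
  | zero => rw [star_zero]
  | add a b _ _ ha hb => rw [star_add]; exact add_nonneg ha hb

/-- The additive monoid generated by the matrices `p e_{i,j}` with `p ≥ 0`. -/
noncomputable def matrixPos (m r : ℕ) : AddSubmonoid (Matrix (Fin m) (Fin m) (Leavitt r)) :=
  AddSubmonoid.closure {A | ∃ i j, ∃ p : Leavitt r, 0 ≤ p ∧ A = Matrix.single i j p}

theorem mem_matrixPos_iff {m r : ℕ} {A : Matrix (Fin m) (Fin m) (Leavitt r)} :
    A ∈ matrixPos m r ↔ ∀ i j, 0 ≤ A i j := by
  constructor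
  · intro hA
    induction hA using AddSubmonoid.closure_induction with
    | mem A hA =>
      obtain ⟨k, l, p, hp, rfl⟩ := hA
      intro i j
      rw [Matrix.single_apply]
      split_ifs
      · exact hp
      · exact le_rfl
    | zero => exact fun _ _ => le_rfl
    | add A B _ _ hA hB => exact fun i j => add_nonneg (hA i j) (hB i j)
  · intro hA
    rw [Matrix.matrix_eq_sum_single A]
    exact sum_mem fun i _ => sum_mem fun j _ =>
      AddSubmonoid.subset_closure ⟨i, j, A i j, hA i j, rfl⟩

/-- The positive cone of the ring of `m × m` matrices over the Leavitt ring. -/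
noncomputable def matrixCone (m r : ℕ) : RingCone (Matrix (Fin m) (Fin m) (Leavitt r)) where
  toAddSubmonoid := matrixPos m r
  one_mem' := mem_matrixPos_iff.2 fun i j => by
    rw [Matrix.one_apply]
    split_ifs
    · exact zero_le_one
    · exact le_rfl
  mul_mem' {A B} hA hB := mem_matrixPos_iff.2 fun i j => by
    rw [Matrix.mul_apply]
    exact Finset.sum_nonneg fun k _ =>
      mul_nonneg (mem_matrixPos_iff.1 hA i k) (mem_matrixPos_iff.1 hB k j)
  eq_zero_of_mem_of_neg_mem' {A} hA hnA := by
    ext i j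
    exact le_antisymm (neg_nonneg.1 (mem_matrixPos_iff.1 hnA i j)) (mem_matrixPos_iff.1 hA i j)

/-- The partial order on matrices: `A ≤ B` if and only if `B - A` is in the cone. -/
noncomputable instance (m r : ℕ) : PartialOrder (Matrix (Fin m) (Fin m) (Leavitt r)) :=
  .mkOfAddGroupCone (matrixCone m r)

instance (m r : ℕ) : IsOrderedRing (Matrix (Fin m) (Fin m) (Leavitt r)) :=
  .mkOfCone (matrixCone m r)

theorem matrix_nonneg_iff {m r : ℕ} {A : Matrix (Fin m) (Fin m) (Leavitt r)} :
    0 ≤ A ↔ A ∈ matrixPos m r := by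
  change A - 0 ∈ matrixPos m r ↔ _
  rw [sub_zero]

theorem matrix_star_nonneg {m r : ℕ} {A : Matrix (Fin m) (Fin m) (Leavitt r)} (hA : 0 ≤ A) :
    0 ≤ star A := by
  rw [matrix_nonneg_iff, mem_matrixPos_iff] at hA ⊢
  exact fun i j => star_nonneg_of_nonneg (hA j i)

end Leavitt

namespace Leavitt

/-! It suffices to find `Y s` in the matrix ring with `star (Y s) * Y t = δ` and `∑ s, Y s * star (Y
s) = 1` that generate, as a star-closed semiring, exactly the matrices with nonnegative entries. The
universal property then sends `y s` to `Y s`. This map is injective by a Cuntz–Krieger uniqueness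
argument (`injective_of_forall_int`). It carries the cone onto the cone, so it is surjective,
because the cone spans, and it reflects the order.

The `Y s` come from moves on graphs. Put k = r - 1 and d = m. The matrices of size 2 + d carry a
Cuntz–Krieger family with three vertex projections, of ranks 1, 1 and d: there are r loops at the
first vertex, and the other two send one and d edges to it. This family generates the nonnegative
matrices. Replacing an edge i → j by its compositions with the edges leaving j (`expand`), or
undoing this (`collapse`), changes neither the projections nor the generated semiring. On B =
adjacency matrix - 1 it adds row j to row i, or subtracts it (`presents_add_row_iff`).

Such row operations, with adjacency entries kept nonnegative, move the loops to the vertex of rank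
d. Coprimality gives d * e = 1 + j * k, hence a 2 × 2 matrix of natural numbers with determinant
one, which Euclid's algorithm factors into row additions (`rel_of_det_eq_one`,
`presentsThree_of_start`). In the final graph every edge leads to the vertex of rank d, so the r
loops there generate its corner, the d × d matrices (`exists_generators_of_presentsThree`). -/

open Finset

/-! ### Cuntz–Krieger families and the semirings they generate -/

/-- A Cuntz–Krieger family in a star ring for the graph with edge set `E`, in which the edge `e`
leads from the vertex `(t e).1` to the vertex `(t e).2`; the vertex `i` is represented by `p i`. -/
structure IsFamily {R ι E : Type*} [Ring R] [StarRing R] [DecidableEq ι] [Fintype E]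
    (p : ι → R) (t : E → ι × ι) (f : E → R) : Prop where
  star_mul_self : ∀ e, star (f e) * f e = p (t e).2
  star_mul_of_ne : ∀ e e', e ≠ e' → star (f e) * f e' = 0
  sum_mul_star : ∀ i, (∑ e, if (t e).1 = i then f e * star (f e) else 0) = p i
  left_mul : ∀ e, p (t e).1 * f e = f e

/-- The star-closed subsemiring generated by a family of elements. -/
def starGen {R E : Type*} [Ring R] [StarRing R] (f : E → R) : Subsemiring R :=
  Subsemiring.closure (Set.range f ∪ Set.range fun e => star (f e))

section starGen

variable {R E E' : Type*} [Ring R] [StarRing R] {f : E → R} {f' : E' → R}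

theorem mem_starGen (e : E) : f e ∈ starGen f :=
  Subsemiring.subset_closure (.inl ⟨e, rfl⟩)

theorem star_mem_starGen {a : R} (ha : a ∈ starGen f) : star a ∈ starGen f := by
  induction ha using Subsemiring.closure_induction with
  | mem z hz =>
    rcases hz with ⟨e, rfl⟩ | ⟨e, rfl⟩
    · exact Subsemiring.subset_closure (.inr ⟨e, rfl⟩)
    · simpa using mem_starGen e
  | zero => simp
  | one => simp
  | add a b _ _ ha hb => rw [star_add]; exact add_mem ha hb
  | mul a b _ _ ha hb => rw [star_mul]; exact mul_mem hb ha

theorem starGen_le (h : ∀ e, f e ∈ starGen f') : starGen f ≤ starGen f' := by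
  refine Subsemiring.closure_le.2 ?_
  rintro _ (⟨e, rfl⟩ | ⟨e, rfl⟩)
  · exact h e
  · exact star_mem_starGen (h e)

theorem starGen_comp_equiv (f : E → R) (g : E' ≃ E) : starGen (f ∘ g) = starGen f := by
  refine le_antisymm (starGen_le fun e => mem_starGen (g e)) (starGen_le fun e => ?_)
  simpa using mem_starGen (f := f ∘ g) (g.symm e)

end starGen

/-! ### Expanding and collapsing an edge -/

namespace IsFamily

variable {R ι E X : Type*} [Ring R] [StarRing R] [DecidableEq ι] [Fintype E] [Fintype X]
  {p : ι → R} {t : E → ι × ι} {f : E → R}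

/-- Writing the source projection in `left_mul` as a sum of range projections leaves only the term
`f e * star (f e) * f e`. -/
theorem mul_right (h : IsFamily p t f) (e : E) : f e * p (t e).2 = f e := by
  have h1 := h.left_mul e
  rw [← h.sum_mul_star, sum_mul, sum_eq_single e] at h1
  · simpa [mul_assoc, h.star_mul_self] using h1
  · intro e' _ hne
    split_ifs
    · rw [mul_assoc, h.star_mul_of_ne _ _ hne, mul_zero]
    · exact zero_mul _
  · simp

theorem comp_equiv (h : IsFamily p t f) (g : X ≃ E) : IsFamily p (t ∘ g) (f ∘ g) where
  star_mul_self e := h.star_mul_self _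
  star_mul_of_ne e e' hne := h.star_mul_of_ne _ _ (g.injective.ne hne)
  sum_mul_star i := by
    rw [← h.sum_mul_star i]
    exact g.sum_comp fun e => if (t e).1 = i then f e * star (f e) else 0
  left_mul e := h.left_mul _

variable {t : X → ι × ι} {i j : ι}

/-- The graph `t` with one more edge, from `i` to `j`. -/
def addEdge (t : X → ι × ι) (i j : ι) : X ⊕ Unit → ι × ι :=
  Sum.elim t fun _ => (i, j)

/-- The graph `t` with one more edge from `i` to the range of every edge that leaves `j`. -/
def addEdges (t : X → ι × ι) (i j : ι) : X ⊕ {x : X // (t x).1 = j} → ι × ι :=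
  Sum.elim t fun g => (i, (t g).2)

theorem sum_edges {M : Type*} [AddCommMonoid M] (F : X → M) :
    (∑ x, if (t x).1 = j then F x else 0) = ∑ g : {x : X // (t x).1 = j}, F g := by
  rw [← sum_filter]
  exact (sum_subtype _ (by simp) _)

/-- Replace an edge from `i` to `j` by its compositions with the edges that leave `j`. -/
theorem expand (hij : i ≠ j) {f : X ⊕ Unit → R} (h : IsFamily p (addEdge t i j) f) :
    ∃ f', IsFamily p (addEdges t i j) f' ∧ starGen f' = starGen f := by
  -- As `i ≠ j`, the extra edge does not leave `j`, so the edges of `t` alone exhaust `p j`.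
  have hsum : ∑ g : {x : X // (t x).1 = j}, f (.inl g) * star (f (.inl g)) = p j := by
    have := h.sum_mul_star j
    rw [Fintype.sum_sum_type] at this
    simp only [addEdge, Sum.elim_inl, Sum.elim_inr, hij, if_false, sum_const_zero, add_zero] at this
    exact (sum_edges _).symm.trans this
  have hl (g : {x : X // (t x).1 = j}) : p j * f (.inl g) = f (.inl g) := by
    have := h.left_mul (.inl g)
    simpa [addEdge, g.2] using this
  have h0 : star (f (.inr ())) * f (.inr ()) = p j := h.star_mul_self (.inr ())
  have h0r : f (.inr ()) * p j = f (.inr ()) := h.mul_right (.inr ())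
  refine ⟨Sum.elim (fun x => f (.inl x)) fun g => f (.inr ()) * f (.inl g), ⟨?_, ?_, ?_, ?_⟩, ?_⟩
  · rintro (x | g)
    · exact h.star_mul_self (.inl x)
    · have := h.star_mul_self (.inl g)
      simp only [Sum.elim_inr, star_mul, addEdges]
      rw [mul_assoc, ← mul_assoc (star (f (.inr ()))), h0, hl, this]
      rfl
  · rintro (x | g) (x' | g') hne
    · exact h.star_mul_of_ne _ _ (by simpa using hne)
    · simp only [Sum.elim_inl, Sum.elim_inr]
      rw [← mul_assoc, h.star_mul_of_ne _ _ (by simp), zero_mul]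
    · simp only [Sum.elim_inl, Sum.elim_inr, star_mul]
      rw [mul_assoc, h.star_mul_of_ne _ _ (by simp), mul_zero]
    · simp only [Sum.elim_inr, star_mul]
      rw [mul_assoc, ← mul_assoc (star (f (.inr ()))), h0, hl, h.star_mul_of_ne]
      simpa [Subtype.ext_iff] using hne
  · intro l
    rw [← h.sum_mul_star l, Fintype.sum_sum_type, Fintype.sum_sum_type]
    congr 1
    simp only [addEdges, addEdge, Sum.elim_inr, star_mul, univ_unique, sum_singleton]
    by_cases hil : i = l
    · have : ∀ g : {x : X // (t x).1 = j}, f (.inr ()) * f (.inl g) *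
          (star (f (.inl g)) * star (f (.inr ()))) =
          f (.inr ()) * (f (.inl g) * star (f (.inl g))) * star (f (.inr ())) := by
        intro g; simp only [mul_assoc]
      simp only [hil, if_true, this]
      rw [← sum_mul, ← mul_sum, hsum, h0r]
    · simp [hil]
  · rintro (x | g)
    · exact h.left_mul (.inl x)
    · have : p i * f (.inr ()) = f (.inr ()) := h.left_mul (.inr ())
      simp only [addEdges, Sum.elim_inr]
      rw [← mul_assoc, this]
  · refine le_antisymm (starGen_le ?_) (starGen_le ?_)
    · rintro (x | g)
      · exact mem_starGen (Sum.inl x)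
      · exact mul_mem (mem_starGen _) (mem_starGen _)
    · set f' : X ⊕ {x : X // (t x).1 = j} → R :=
        Sum.elim (fun x => f (.inl x)) fun g => f (.inr ()) * f (.inl g) with hf'
      rintro (x | u)
      · exact mem_starGen (f := f') (Sum.inl x)
      -- The removed edge is recovered from its compositions, because the edges leaving `j` sum to
      -- `p j`.
      · have : f (.inr u) = ∑ g, f' (.inr g) * star (f' (.inl g)) := by
          simp only [hf', Sum.elim_inr, Sum.elim_inl, mul_assoc]
          rw [← mul_sum, hsum, h0r]
        rw [this]
        exact sum_mem fun g _ => mul_mem (mem_starGen _) (star_mem_starGen (mem_starGen _))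

/-- The inverse of `expand`. -/
theorem collapse (hij : i ≠ j) {f : X ⊕ {x : X // (t x).1 = j} → R}
    (h : IsFamily p (addEdges t i j) f) :
    ∃ f', IsFamily p (addEdge t i j) f' ∧ starGen f' = starGen f := by
  have hsum : ∑ g : {x : X // (t x).1 = j}, f (.inl g) * star (f (.inl g)) = p j := by
    have := h.sum_mul_star j
    rw [Fintype.sum_sum_type] at this
    simp only [addEdges, Sum.elim_inl, Sum.elim_inr, hij, if_false, sum_const_zero, add_zero] at this
    exact (sum_edges _).symm.trans this
  have hr (g : {x : X // (t x).1 = j}) : f (.inr g) * p (t g).2 = f (.inr g) :=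
    h.mul_right (.inr g)
  have hr' (x : X) : f (.inl x) * p (t x).2 = f (.inl x) := h.mul_right (.inl x)
  set f₀ : R := ∑ g : {x : X // (t x).1 = j}, f (.inr g) * star (f (.inl g)) with hf₀
  have hmul (g : {x : X // (t x).1 = j}) : f₀ * f (.inl g) = f (.inr g) := by
    rw [hf₀, sum_mul, sum_eq_single g]
    · rw [mul_assoc, h.star_mul_self]
      exact hr g
    · intro g' _ hne
      rw [mul_assoc, h.star_mul_of_ne, mul_zero]
      simpa [Subtype.ext_iff] using hne
    · simp
  have hstar : star f₀ = ∑ g : {x : X // (t x).1 = j}, f (.inl g) * star (f (.inr g)) := by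
    simp [hf₀]
  have hmul' (g : {x : X // (t x).1 = j}) : star f₀ * f (.inr g) = f (.inl g) := by
    rw [hstar, sum_mul, sum_eq_single g]
    · rw [mul_assoc, h.star_mul_self]
      exact hr' g
    · intro g' _ hne
      rw [mul_assoc, h.star_mul_of_ne, mul_zero]
      simpa [Subtype.ext_iff] using hne
    · simp
  have hzero (x : X) : star f₀ * f (.inl x) = 0 := by
    rw [hstar, sum_mul]
    refine sum_eq_zero fun g _ => ?_
    rw [mul_assoc, h.star_mul_of_ne _ _ (by simp), mul_zero]
  refine ⟨Sum.elim (fun x => f (.inl x)) fun _ => f₀, ⟨?_, ?_, ?_, ?_⟩, ?_⟩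
  · rintro (x | u)
    · exact h.star_mul_self (.inl x)
    · simp only [Sum.elim_inr, addEdge]
      -- In effect only the right factor is expanded: `star f₀` turns each composed edge back into
      -- the edge leaving `j`, and `hsum` applies.
      conv_lhs => rw [hf₀, ← hf₀, hf₀, mul_sum]
      simp only [← mul_assoc, ← hf₀, hmul', hsum]
  · rintro (x | u) (x' | u') hne
    · exact h.star_mul_of_ne _ _ (by simpa using hne)
    · simpa using congrArg star (hzero x)
    · exact hzero x'
    · exact absurd rfl hne
  · intro l
    rw [← h.sum_mul_star l, Fintype.sum_sum_type, Fintype.sum_sum_type]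
    congr 1
    simp only [addEdges, addEdge, Sum.elim_inr, univ_unique, sum_singleton]
    by_cases hil : i = l
    · simp only [hil, if_true]
      rw [hstar, mul_sum]
      simp only [← mul_assoc, hmul]
    · simp [hil]
  · rintro (x | u)
    · exact h.left_mul (.inl x)
    · simp only [addEdge, Sum.elim_inr]
      rw [hf₀, mul_sum]
      refine sum_congr rfl fun g _ => ?_
      have : p i * f (.inr g) = f (.inr g) := h.left_mul (.inr g)
      rw [← mul_assoc, this]
  · refine le_antisymm (starGen_le ?_) (starGen_le ?_)
    · rintro (x | u)
      · exact mem_starGen (Sum.inl x)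
      · exact sum_mem fun g _ => mul_mem (mem_starGen _) (star_mem_starGen (mem_starGen _))
    · set f' : X ⊕ Unit → R := Sum.elim (fun x => f (.inl x)) fun _ => f₀ with hf'
      rintro (x | g)
      · exact mem_starGen (f := f') (Sum.inl x)
      · rw [← hmul]
        exact mul_mem (mem_starGen (f := f') (Sum.inr ())) (mem_starGen (f := f') (Sum.inl g))

end IsFamily

/-! ### Presentations by integer matrices, and row operations -/

/-- There is a Cuntz–Krieger family which generates `P`, for a graph whose adjacency matrix is
`1 + B`. -/
def Presents {R : Type*} {ι : Type} [Ring R] [StarRing R] [DecidableEq ι] (p : ι → R) (P : Subsemiring R)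
    (B : ι → ι → ℤ) : Prop :=
  ∃ (E : Type) (_ : Fintype E) (t : E → ι × ι) (f : E → R), IsFamily p t f ∧ starGen f = P ∧
    ∀ i j, (Nat.card {e // t e = (i, j)} : ℤ) = B i j + if i = j then 1 else 0

theorem exists_equiv_of_card_fiber_eq {E E' Q : Type*} [Finite E] [Finite E'] {t : E → Q}
    {t' : E' → Q} (h : ∀ q, Nat.card {e // t e = q} = Nat.card {e // t' e = q}) :
    ∃ g : E' ≃ E, t ∘ g = t' := by
  have g (q : Q) : {e // t' e = q} ≃ {e // t e = q} := (Finite.card_eq.1 (h q).symm).some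
  refine ⟨(Equiv.sigmaFiberEquiv t').symm.trans
    ((Equiv.sigmaCongrRight g).trans (Equiv.sigmaFiberEquiv t)), funext fun e => ?_⟩
  exact (g (t' e) ⟨e, rfl⟩).2

theorem card_fiber_sum {X Y Q : Type*} [Finite X] [Finite Y] (t : X → Q) (t' : Y → Q) (q : Q) :
    Nat.card {e // Sum.elim t t' e = q} =
      Nat.card {x // t x = q} + Nat.card {y // t' y = q} := by
  rw [← Nat.card_sum]
  exact Nat.card_congr (Equiv.subtypeSum)

theorem card_fiber_const (X : Type*) {Q : Type*} [DecidableEq Q] (a q : Q) :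
    Nat.card {_x : X // a = q} = if a = q then Nat.card X else 0 := by
  split_ifs with h
  · exact Nat.card_congr (Equiv.subtypeUnivEquiv fun _ => h)
  · simp [h]

section Presents

variable {R : Type*} {ι : Type} [Ring R] [StarRing R] [DecidableEq ι] {p : ι → R} {P : Subsemiring R}

/-- Edges may be relabelled, so only their number between each pair of vertices matters. The moves
can thus use an edge set with a distinguished summand. -/
theorem Presents.exists_of_card {B : ι → ι → ℤ} (h : Presents p P B) {E : Type} [Fintype E]
    {t : E → ι × ι}
    (ht : ∀ i j, (Nat.card {e // t e = (i, j)} : ℤ) = B i j + if i = j then 1 else 0) :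
    ∃ f, IsFamily p t f ∧ starGen f = P := by
  obtain ⟨E', _, t', f, hf, hP, hB⟩ := h
  obtain ⟨g, rfl⟩ := exists_equiv_of_card_fiber_eq (t := t') (t' := t) fun ⟨i, j⟩ => by
    exact_mod_cast (hB i j).trans (ht i j).symm
  exact ⟨f ∘ g, hf.comp_equiv g, (starGen_comp_equiv f g).trans hP⟩

/-- Adding the row `j` to the row `i` if there is an edge from `i` to `j`. -/
theorem presents_add_row_iff [Fintype ι] {B B' : ι → ι → ℤ} {i j : ι} (hij : i ≠ j)
    (hB : 1 ≤ B i j) (hB0 : ∀ a b, 0 ≤ B a b + if a = b then 1 else 0)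
    (hB' : ∀ a b, B' a b = B a b + if a = i then B j b else 0) :
    Presents p P B ↔ Presents p P B' := by
  -- The edge numbers after removal of one edge `i → j`; by `hB` and `hB0` nothing is truncated.
  let N : ι × ι → ℕ := fun q =>
    (B q.1 q.2 + (if q.1 = q.2 then 1 else 0) - if (i, j) = q then 1 else 0).toNat
  let X := Σ q : ι × ι, Fin (N q)
  let t : X → ι × ι := Sigma.fst
  have hN (q : ι × ι) : Nat.card {x // t x = q} = N q := by
    rw [Nat.card_congr (Equiv.sigmaSubtype q), Nat.card_fin]
  have hX (a b : ι) : (Nat.card {x // t x = (a, b)} : ℤ) =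
      B a b + (if a = b then 1 else 0) - if (i, j) = (a, b) then 1 else 0 := by
    rw [hN, Int.toNat_of_nonneg]
    have := hB0 a b
    by_cases h : (i, j) = (a, b)
    · obtain ⟨rfl, rfl⟩ := Prod.mk.inj h
      simpa [hij] using hB
    · simpa [h] using this
  have h1 (a b : ι) : (Nat.card {x // IsFamily.addEdge t i j x = (a, b)} : ℤ) =
      B a b + if a = b then 1 else 0 := by
    rw [IsFamily.addEdge, card_fiber_sum, card_fiber_const, Nat.card_unique (α := Unit), Nat.cast_add, hX]
    push_cast
    ring
  have h2 (a b : ι) : (Nat.card {x // IsFamily.addEdges t i j x = (a, b)} : ℤ) =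
      B' a b + if a = b then 1 else 0 := by
    have : (Nat.card {g : {x : X // (t x).1 = j} // (i, (t g).2) = (a, b)} : ℤ) =
        if a = i then B j b + if j = b then 1 else 0 else 0 := by
      by_cases h : a = i
      · subst h
        have e : {g : {x : X // (t x).1 = j} // (a, (t g).2) = (a, b)} ≃
            {x : X // t x = (j, b)} :=
          (Equiv.subtypeSubtypeEquivSubtypeInter (fun x => (t x).1 = j)
            (fun x => (a, (t x).2) = (a, b))).trans
            (Equiv.subtypeEquivRight fun x => by simp [Prod.ext_iff])
        rw [Nat.card_congr e, hX]
        simp [hij]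
      · have : IsEmpty {g : {x : X // (t x).1 = j} // (i, (t g).2) = (a, b)} :=
          ⟨fun g => h (Prod.mk.inj g.2).1.symm⟩
        simp only [Nat.card_of_isEmpty, h, if_false, Nat.cast_zero]
    rw [IsFamily.addEdges, card_fiber_sum, Nat.cast_add, hX, this, hB']
    by_cases ha : a = i
    · subst ha
      by_cases hb : j = b <;> simp [hb] <;> ring
    · simp [ha, Ne.symm ha]
  constructor
  · intro h
    obtain ⟨f, hf, hP⟩ := h.exists_of_card h1
    obtain ⟨f', hf', hP'⟩ := hf.expand hij
    exact ⟨_, _, _, f', hf', hP'.trans hP, h2⟩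
  · intro h
    obtain ⟨f, hf, hP⟩ := h.exists_of_card h2
    obtain ⟨f', hf', hP'⟩ := hf.collapse hij
    exact ⟨_, _, _, f', hf', hP'.trans hP, h1⟩

end Presents

section rows

variable {R : Type*} {ι : Type} [Ring R] [StarRing R] [DecidableEq ι] {p : ι → R}
  {P : Subsemiring R}

theorem Presents.nonneg {B : ι → ι → ℤ} (h : Presents p P B) (a b : ι) :
    0 ≤ B a b + if a = b then 1 else 0 := by
  obtain ⟨E, _, t, f, -, -, hB⟩ := h
  rw [← hB]
  positivity

theorem Presents.add_row [Fintype ι] {B : ι → ι → ℤ} (h : Presents p P B) {i j : ι} (hij : i ≠ j)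
    (hB : 1 ≤ B i j) : Presents p P fun a b => B a b + if a = i then B j b else 0 :=
  (presents_add_row_iff hij hB h.nonneg fun _ _ => rfl).1 h

/-- Here `B` is the matrix after the row addition, so the conditions concern the difference of rows:
it must contain an edge `i → j` and have nonnegative adjacency entries. -/
theorem Presents.sub_row [Fintype ι] {B : ι → ι → ℤ} (h : Presents p P B) {i j : ι} (hij : i ≠ j)
    (hB : 1 ≤ B i j - B j j) (hB0 : ∀ b, 0 ≤ B i b - B j b + if i = b then 1 else 0) :
    Presents p P fun a b => B a b - if a = i then B j b else 0 := by
  refine (presents_add_row_iff (B' := B) hij (by simpa using hB) (fun a b => ?_)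
    fun a b => ?_).2 h
  · by_cases ha : a = i
    · subst ha
      simpa using hB0 b
    · simpa [ha] using h.nonneg a b
  · simp [hij.symm]

end rows

/-! ### Three vertices: row operations and Euclid's algorithm -/

section three

variable {R : Type*} [Ring R] [StarRing R] {p : Fin 3 → R} {P : Subsemiring R}

/-- `Presents` for a graph with three vertices. -/
def PresentsThree (p : Fin 3 → R) (P : Subsemiring R) (v₁ v₂ v₃ u₁ u₂ u₃ w₁ w₂ w₃ : ℤ) : Prop :=
  Presents p P ![![v₁, v₂, v₃], ![u₁, u₂, u₃], ![w₁, w₂, w₃]]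

namespace PresentsThree

variable {v₁ v₂ v₃ u₁ u₂ u₃ w₁ w₂ w₃ : ℤ}

theorem add_vu (h : PresentsThree p P v₁ v₂ v₃ u₁ u₂ u₃ w₁ w₂ w₃) (h1 : 1 ≤ v₂) :
    PresentsThree p P (v₁ + u₁) (v₂ + u₂) (v₃ + u₃) u₁ u₂ u₃ w₁ w₂ w₃ := by
  unfold PresentsThree
  convert Presents.add_row h (i := 0) (j := 1) (by decide) h1 using 1
  ext a b; fin_cases a <;> fin_cases b <;> simp

theorem add_uv (h : PresentsThree p P v₁ v₂ v₃ u₁ u₂ u₃ w₁ w₂ w₃) (h1 : 1 ≤ u₁) :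
    PresentsThree p P v₁ v₂ v₃ (u₁ + v₁) (u₂ + v₂) (u₃ + v₃) w₁ w₂ w₃ := by
  unfold PresentsThree
  convert Presents.add_row h (i := 1) (j := 0) (by decide) h1 using 1
  ext a b; fin_cases a <;> fin_cases b <;> simp

theorem add_uw (h : PresentsThree p P v₁ v₂ v₃ u₁ u₂ u₃ w₁ w₂ w₃) (h1 : 1 ≤ u₃) :
    PresentsThree p P v₁ v₂ v₃ (u₁ + w₁) (u₂ + w₂) (u₃ + w₃) w₁ w₂ w₃ := by
  unfold PresentsThree
  convert Presents.add_row h (i := 1) (j := 2) (by decide) h1 using 1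
  ext a b; fin_cases a <;> fin_cases b <;> simp

theorem add_wv (h : PresentsThree p P v₁ v₂ v₃ u₁ u₂ u₃ w₁ w₂ w₃) (h1 : 1 ≤ w₁) :
    PresentsThree p P v₁ v₂ v₃ u₁ u₂ u₃ (w₁ + v₁) (w₂ + v₂) (w₃ + v₃) := by
  unfold PresentsThree
  convert Presents.add_row h (i := 2) (j := 0) (by decide) h1 using 1
  ext a b; fin_cases a <;> fin_cases b <;> simp

theorem add_wu (h : PresentsThree p P v₁ v₂ v₃ u₁ u₂ u₃ w₁ w₂ w₃) (h1 : 1 ≤ w₂) :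
    PresentsThree p P v₁ v₂ v₃ u₁ u₂ u₃ (w₁ + u₁) (w₂ + u₂) (w₃ + u₃) := by
  unfold PresentsThree
  convert Presents.add_row h (i := 2) (j := 1) (by decide) h1 using 1
  ext a b; fin_cases a <;> fin_cases b <;> simp

theorem sub_vu (h : PresentsThree p P v₁ v₂ v₃ u₁ u₂ u₃ w₁ w₂ w₃) (h1 : 0 ≤ v₁ - u₁ + 1)
    (h2 : 1 ≤ v₂ - u₂) (h3 : 0 ≤ v₃ - u₃) :
    PresentsThree p P (v₁ - u₁) (v₂ - u₂) (v₃ - u₃) u₁ u₂ u₃ w₁ w₂ w₃ := by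
  unfold PresentsThree
  convert Presents.sub_row h (i := 0) (j := 1) (by decide) h2 fun b => ?_ using 1
  · ext a b; fin_cases a <;> fin_cases b <;> simp
  · fin_cases b <;> simp <;> linarith

theorem sub_vw (h : PresentsThree p P v₁ v₂ v₃ u₁ u₂ u₃ w₁ w₂ w₃) (h1 : 0 ≤ v₁ - w₁ + 1)
    (h2 : 0 ≤ v₂ - w₂) (h3 : 1 ≤ v₃ - w₃) :
    PresentsThree p P (v₁ - w₁) (v₂ - w₂) (v₃ - w₃) u₁ u₂ u₃ w₁ w₂ w₃ := by
  unfold PresentsThree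
  convert Presents.sub_row h (i := 0) (j := 2) (by decide) h3 fun b => ?_ using 1
  · ext a b; fin_cases a <;> fin_cases b <;> simp
  · fin_cases b <;> simp <;> linarith

theorem sub_uv (h : PresentsThree p P v₁ v₂ v₃ u₁ u₂ u₃ w₁ w₂ w₃) (h1 : 1 ≤ u₁ - v₁)
    (h2 : 0 ≤ u₂ - v₂ + 1) (h3 : 0 ≤ u₃ - v₃) :
    PresentsThree p P v₁ v₂ v₃ (u₁ - v₁) (u₂ - v₂) (u₃ - v₃) w₁ w₂ w₃ := by
  unfold PresentsThree
  convert Presents.sub_row h (i := 1) (j := 0) (by decide) h1 fun b => ?_ using 1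
  · ext a b; fin_cases a <;> fin_cases b <;> simp
  · fin_cases b <;> simp <;> linarith

theorem sub_uw (h : PresentsThree p P v₁ v₂ v₃ u₁ u₂ u₃ w₁ w₂ w₃) (h1 : 0 ≤ u₁ - w₁)
    (h2 : 0 ≤ u₂ - w₂ + 1) (h3 : 1 ≤ u₃ - w₃) :
    PresentsThree p P v₁ v₂ v₃ (u₁ - w₁) (u₂ - w₂) (u₃ - w₃) w₁ w₂ w₃ := by
  unfold PresentsThree
  convert Presents.sub_row h (i := 1) (j := 2) (by decide) h3 fun b => ?_ using 1
  · ext a b; fin_cases a <;> fin_cases b <;> simp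
  · fin_cases b <;> simp <;> linarith

theorem sub_wv (h : PresentsThree p P v₁ v₂ v₃ u₁ u₂ u₃ w₁ w₂ w₃) (h1 : 1 ≤ w₁ - v₁)
    (h2 : 0 ≤ w₂ - v₂) (h3 : 0 ≤ w₃ - v₃ + 1) :
    PresentsThree p P v₁ v₂ v₃ u₁ u₂ u₃ (w₁ - v₁) (w₂ - v₂) (w₃ - v₃) := by
  unfold PresentsThree
  convert Presents.sub_row h (i := 2) (j := 0) (by decide) h1 fun b => ?_ using 1
  · ext a b; fin_cases a <;> fin_cases b <;> simp
  · fin_cases b <;> simp <;> linarith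

end PresentsThree

/-- A relation between two vectors which is preserved by adding either one to the other is
preserved by every matrix with natural entries and determinant one. -/
theorem rel_of_det_eq_one {M : Type*} [AddCommMonoid M] {Q : M → M → Prop}
    (h1 : ∀ x y, Q x y → Q (x + y) y) (h2 : ∀ x y, Q x y → Q x (y + x)) {x y : M} (h : Q x y) :
    ∀ n a b c d : ℕ, a + b + c + d ≤ n → a * d = b * c + 1 →
      Q (a • x + b • y) (c • x + d • y) := by
  intro n
  induction n with
  | zero =>
    intro a b c d hn hdet
    obtain rfl : a = 0 := by omega
    omega
  | succ n ih =>
    intro a b c d hn hdet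
    by_cases hca : c ≤ a ∧ d ≤ b
    · obtain ⟨⟨a, rfl⟩, b, rfl⟩ := hca.imp Nat.exists_eq_add_of_le Nat.exists_eq_add_of_le
      -- This makes the sum of the entries drop when the lower row is subtracted.
      have hd : d ≠ 0 := by rintro rfl; simp at hdet
      have := h1 _ _ (ih a b c d (by omega) (by nlinarith))
      convert this using 1
      simp only [add_smul]
      abel
    by_cases hac : a ≤ c ∧ b ≤ d
    · obtain ⟨⟨c, rfl⟩, d, rfl⟩ := hac.imp Nat.exists_eq_add_of_le Nat.exists_eq_add_of_le
      have ha : a ≠ 0 := by rintro rfl; simp at hdet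
      have := h2 _ _ (ih a b c d (by omega) (by nlinarith))
      convert this using 1
      simp only [add_smul]
      abel
    rcases lt_or_ge c a with hc | hc
    -- Neither row dominates the other: `(c + 1) * (b + 1) ≤ a * d = b * c + 1` leaves only the
    -- identity matrix.
    · have hb : b + 1 ≤ d := by omega
      have h3 := Nat.mul_le_mul (Nat.succ_le_of_lt hc) hb
      have hb0 : b = 0 := by nlinarith
      have hc0 : c = 0 := by nlinarith
      subst hb0 hc0
      have h4 : a = 1 ∧ d = 1 := by simpa using hdet
      simpa [h4.1, h4.2] using h
    -- Now `a * d ≤ c * b`, against determinant one.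
    · have hd : d ≤ b := by omega
      have := Nat.mul_le_mul hc hd
      nlinarith

section chain

variable {k d e j : ℤ}

theorem PresentsThree.add_uv_iterate {v₁ v₂ v₃ u₁ u₂ u₃ w₁ w₂ w₃ : ℤ} (t : ℕ)
    (h : PresentsThree p P v₁ v₂ v₃ u₁ u₂ u₃ w₁ w₂ w₃) (hv : 0 ≤ v₁) (hu : 1 ≤ u₁) :
    PresentsThree p P v₁ v₂ v₃ (u₁ + t * v₁) (u₂ + t * v₂) (u₃ + t * v₃) w₁ w₂ w₃ := by
  induction t with
  | zero => simpa using h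
  | succ t ih =>
    convert ih.add_uv (by nlinarith) using 1 <;> push_cast <;> ring

theorem PresentsThree.add_uw_iterate {v₁ v₂ v₃ u₁ u₂ u₃ w₁ w₂ w₃ : ℤ} (t : ℕ)
    (h : PresentsThree p P v₁ v₂ v₃ u₁ u₂ u₃ w₁ w₂ w₃) (hw : 0 ≤ w₃) (hu : 1 ≤ u₃) :
    PresentsThree p P v₁ v₂ v₃ (u₁ + t * w₁) (u₂ + t * w₂) (u₃ + t * w₃) w₁ w₂ w₃ := by
  induction t with
  | zero => simpa using h
  | succ t ih =>
    convert ih.add_uw (by nlinarith) using 1 <;> push_cast <;> ring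

theorem PresentsThree.sub_uv_iterate {v₁ v₂ v₃ u₁ u₂ u₃ w₁ w₂ w₃ : ℤ} (t : ℕ)
    (h : PresentsThree p P v₁ v₂ v₃ (u₁ + t * v₁) (u₂ + t * v₂) (u₃ + t * v₃) w₁ w₂ w₃)
    (hv₁ : 0 ≤ v₁) (hv₂ : 0 ≤ v₂) (hv₃ : 0 ≤ v₃) (h₁ : 1 ≤ u₁) (h₂ : 0 ≤ u₂ + 1) (h₃ : 0 ≤ u₃) :
    PresentsThree p P v₁ v₂ v₃ u₁ u₂ u₃ w₁ w₂ w₃ := by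
  induction t with
  | zero => simpa using h
  | succ t ih =>
    apply ih
    push_cast at h
    convert h.sub_uv (by nlinarith) (by nlinarith) (by nlinarith) using 1 <;> ring

theorem PresentsThree.sub_wv_iterate {v₁ v₂ v₃ u₁ u₂ u₃ w₁ w₂ w₃ : ℤ} (t : ℕ)
    (h : PresentsThree p P v₁ v₂ v₃ u₁ u₂ u₃ (w₁ + t * v₁) (w₂ + t * v₂) (w₃ + t * v₃))
    (hv₁ : 0 ≤ v₁) (hv₂ : 0 ≤ v₂) (hv₃ : 0 ≤ v₃) (h₁ : 1 ≤ w₁) (h₂ : 0 ≤ w₂) (h₃ : 0 ≤ w₃ + 1) :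
    PresentsThree p P v₁ v₂ v₃ u₁ u₂ u₃ w₁ w₂ w₃ := by
  induction t with
  | zero => simpa using h
  | succ t ih =>
    apply ih
    push_cast at h
    convert h.sub_wv (by nlinarith) (by nlinarith) (by nlinarith) using 1 <;> ring

theorem PresentsThree.sub_vw_iterate {v₁ v₂ v₃ u₁ u₂ u₃ w₁ w₂ w₃ : ℤ} (t : ℕ)
    (h : PresentsThree p P (v₁ + t * w₁) (v₂ + t * w₂) (v₃ + t * w₃) u₁ u₂ u₃ w₁ w₂ w₃)
    (hw₁ : 0 ≤ w₁) (hw₂ : 0 ≤ w₂) (hw₃ : 0 ≤ w₃) (h₁ : 0 ≤ v₁ + 1) (h₂ : 0 ≤ v₂) (h₃ : 1 ≤ v₃) :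
    PresentsThree p P v₁ v₂ v₃ u₁ u₂ u₃ w₁ w₂ w₃ := by
  induction t with
  | zero => simpa using h
  | succ t ih =>
    apply ih
    push_cast at h
    convert h.sub_vw (by nlinarith) (by nlinarith) (by nlinarith) using 1 <;> ring

/-- A presentation with first row `(k - 1, 1, 0)`, in which the other two rows are `x` and `y` up
to multiples of the first one. -/
def PresentsMod (p : Fin 3 → R) (P : Subsemiring R) (k : ℤ) (x y : ℤ × ℤ) : Prop :=
  ∃ a b : ℤ, 1 ≤ a ∧ 1 ≤ b ∧ 1 ≤ x.1 + a * (k - 1) ∧ 1 ≤ y.1 + b * (k - 1) ∧ 1 ≤ x.2 ∧ 0 ≤ y.2 ∧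
    PresentsThree p P (k - 1) 1 0 (x.1 + a * (k - 1)) a x.2 (y.1 + b * (k - 1)) b y.2

/-- The multiples of the first row just add up. The inequalities in `PresentsMod` supply the edge
that the addition needs, and survive it. -/
theorem PresentsMod.add_left {x y : ℤ × ℤ} (h : PresentsMod p P k x y) :
    PresentsMod p P k (x + y) y := by
  obtain ⟨a, b, ha, hb, hx, hy, hx2, hy2, h⟩ := h
  refine ⟨a + b, b, by linarith, hb, ?_, hy, ?_, hy2, ?_⟩
  · rw [Prod.fst_add]; linarith
  · rw [Prod.snd_add]; linarith
  · convert h.add_uw hx2 using 1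
    · rw [Prod.fst_add]; ring
    · rfl

theorem PresentsMod.add_right {x y : ℤ × ℤ} (h : PresentsMod p P k x y) :
    PresentsMod p P k x (y + x) := by
  obtain ⟨a, b, ha, hb, hx, hy, hx2, hy2, h⟩ := h
  refine ⟨a, b + a, ha, by linarith, hx, ?_, hx2, ?_, ?_⟩
  · rw [Prod.fst_add]; linarith
  · rw [Prod.snd_add]; linarith
  · convert h.add_wu hb using 1
    · rw [Prod.fst_add]; ring
    · rfl

/-- Once the first row is `(k - 1, 1, 0)`, the second row `(1, -1, 0)` is `(k, 0, 0)` modulo it. In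
the first and third coordinates the rows then run from `(k, 0)` and `(d, -1)` through `(k - d, 1)`,
then `(k, 0)` in the third row, to `(-d, 1)`. -/
theorem presentsMod_of_start (hk : 2 ≤ k) (hd : 1 ≤ d)
    (h : PresentsThree p P k 0 0 1 (-1) 0 d 0 (-1)) : PresentsMod p P k (-d, 1) (k, 0) := by
  lift d to ℕ using by linarith
  have h1 := h.sub_vu (by linarith) (by norm_num) (by norm_num)
  -- With `d + 2` copies, the entries stay nonnegative in the subtraction `h3`, even for `k = 2`;
  -- the same number serves in `h5`.
  have h2 := (h1.add_uv_iterate (d + 2) (by linarith) le_rfl).add_wv hd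
  have h3 := h2.sub_uw (by push_cast; nlinarith) (by push_cast; linarith) (by norm_num)
  have h4 := h3.add_wu (by norm_num)
  have h5 := h4.add_uv_iterate (d + 2) (by linarith) (by push_cast; nlinarith)
  have h6 := h5.sub_uw (by push_cast; nlinarith) (by push_cast; nlinarith) (by norm_num)
  refine ⟨d + 1, d + 1, by linarith, by linarith, by nlinarith, by nlinarith, le_rfl, le_rfl, ?_⟩
  convert h6 using 1 <;> push_cast <;> ring

/-- The entry 1 in `(1, k - e)` makes the third row a pivot: it clears the first column of the first
row down to the diagonal `-1`, and becomes `(0, 0, k)` itself. -/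
theorem presentsThree_of_mod (hk : 2 ≤ k) (he : 1 ≤ e) (hek : e < k)
    (h : PresentsMod p P k (0, k) (1, k - e)) :
    ∃ f, PresentsThree p P (-1) 0 e 0 (-1) f 0 0 k := by
  lift k to ℕ using by linarith
  obtain ⟨a, b, ha, hb, -, -, -, -, h⟩ := h
  -- One copy of the first row must stay in the second, whose first entry would otherwise be 0; the
  -- third row can lose all `b` copies.
  obtain ⟨a, rfl⟩ : ∃ n : ℕ, a = 1 + n := ⟨(a - 1).toNat, by omega⟩
  lift b to ℕ using by linarith
  have h1 : PresentsThree p P (k - 1) 1 0 (k - 1) 1 k 1 0 (k - e) := by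
    refine PresentsThree.sub_uv_iterate a (PresentsThree.sub_wv_iterate b ?_ ?_ ?_ ?_ ?_ ?_ ?_)
      ?_ ?_ ?_ ?_ ?_ ?_ <;> try linarith
    convert h using 1 <;> ring
  -- The `k` copies let the first row, after receiving the second, lose `k + 1` copies of the third
  -- and end at `k - (k + 1) = -1` and `k + k * (k - e) - (k + 1) * (k - e) = e`.
  have h2 := h1.add_uw_iterate k (by linarith) (by linarith)
  have h3 : PresentsThree p P (k - 1) 1 0 1 (-1) (k + k * (k - e)) 1 0 (k - e) := by
    refine PresentsThree.sub_uv_iterate 2 ?_ ?_ ?_ ?_ ?_ ?_ ?_ <;> try nlinarith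
    convert h2 using 1 <;> push_cast <;> ring
  have h4 := h3.add_vu le_rfl
  have h5 : PresentsThree p P (-1) 0 e 1 (-1) (k + k * (k - e)) 1 0 (k - e) := by
    refine PresentsThree.sub_vw_iterate (k + 1) ?_ ?_ ?_ ?_ ?_ ?_ ?_ <;> try linarith
    convert h4 using 1 <;> push_cast <;> ring
  have h6 := (h5.add_wv le_rfl).add_uv le_rfl
  refine ⟨k + k * (k - e) + e, ?_⟩
  convert h6 using 1 <;> ring

/-- Passing from the obvious presentation of `k + 1` loops at `v` and two sources, which emit one
and `d` edges to `v`, to one of `k + 1` loops at `w` and two sources. -/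
theorem presentsThree_of_start (hk : 2 ≤ k) (hd : 1 ≤ d) (he : 1 ≤ e) (hek : e < k)
    (hde : d * e = 1 + j * k) (h : PresentsThree p P k 0 0 1 (-1) 0 d 0 (-1)) :
    ∃ f, PresentsThree p P (-1) 0 e 0 (-1) f 0 0 k := by
  refine presentsThree_of_mod hk he hek ?_
  have hj : 0 ≤ d - j := by
    by_contra hj
    nlinarith
  -- The matrix with rows `(k, d)` and `(k - e, d - j)` takes `(-d, 1)`, `(k, 0)` to `(0, k)`, `(1,
  -- k - e)`; its determinant is `d * e - j * k = 1`.
  have := rel_of_det_eq_one (Q := PresentsMod p P k) (fun _ _ => PresentsMod.add_left)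
    (fun _ _ => PresentsMod.add_right) (presentsMod_of_start hk hd h) _ k.toNat d.toNat
    (k - e).toNat (d - j).toNat le_rfl (by
      zify
      rw [Int.toNat_of_nonneg, Int.toNat_of_nonneg, Int.toNat_of_nonneg, Int.toNat_of_nonneg] <;>
        linarith)
  simp only [← natCast_zsmul] at this
  rw [Int.toNat_of_nonneg (by linarith), Int.toNat_of_nonneg (by linarith),
    Int.toNat_of_nonneg (by linarith), Int.toNat_of_nonneg (by linarith)] at this
  convert this using 1 <;> ext <;> simp <;> linarith

end chain

end three

/-! ### The corner at the vertex of rank `d` -/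

open Matrix

section corner

variable {A : Type*} [Ring A] [StarRing A] {d : ℕ}

/-- Orthogonal projections of ranks one, one and `d` with sum one. -/
def vertexProj (A : Type*) [Ring A] (d : ℕ) (i : Fin 3) :
    Matrix (Fin 2 ⊕ Fin d) (Fin 2 ⊕ Fin d) A :=
  diagonal fun a => if Sum.elim Fin.castSucc (fun _ => 2) a = i then 1 else 0

/-- The isometry onto the last projection. -/
def lastIsometry (A : Type*) [Ring A] (d : ℕ) : Matrix (Fin 2 ⊕ Fin d) (Fin d) A :=
  fromRows 0 1

theorem conjTranspose_lastIsometry_mul :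
    (lastIsometry A d)ᴴ * lastIsometry A d = 1 := by
  rw [lastIsometry, conjTranspose_fromRows_eq_fromCols_conjTranspose, fromCols_mul_fromRows]
  simp

theorem lastIsometry_mul_conjTranspose :
    lastIsometry A d * (lastIsometry A d)ᴴ = vertexProj A d 2 := by
  rw [lastIsometry, conjTranspose_fromRows_eq_fromCols_conjTranspose, fromRows_mul_fromCols]
  ext (a | a) (b | b)
  · have : a.castSucc ≠ 2 := a.castSucc_lt_last.ne
    simp [vertexProj, diagonal_apply, this]
  · simp [vertexProj]
  · simp [vertexProj]
  · simp [vertexProj, diagonal_apply, one_apply]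

omit [StarRing A] in
theorem vertexProj_mul_of_ne {i j : Fin 3} (h : i ≠ j) : vertexProj A d i * vertexProj A d j = 0 := by
  rw [vertexProj, vertexProj, diagonal_mul_diagonal, ← diagonal_zero]
  congr 1
  ext a
  split_ifs with h1 h2
  · exact absurd (h1.symm.trans h2) h
  all_goals simp

omit [StarRing A] in
theorem sum_vertexProj : ∑ i, vertexProj A d i = 1 := by
  ext a b
  rw [Matrix.sum_apply]
  by_cases hab : a = b
  · subst hab
    simp [vertexProj]
  · simp [vertexProj, hab]

/-- A star-closed subsemiring of a corner contains the compressions of the elements which are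
generated by `f`, if it contains those of `f`. -/
theorem compression_mem_of_mem_starGen {J D G E : Type*} [Fintype J] [DecidableEq J] [Fintype D]
    [DecidableEq D] [Fintype G] {f : E → Matrix J J A} {g : G → Matrix J D A}
    {S : Subsemiring (Matrix D D A)} (hS : ∀ a ∈ S, star a ∈ S)
    (hg : ∀ a b, (g a)ᴴ * g b ∈ S) (hsum : ∑ a, g a * (g a)ᴴ = 1)
    (hf : ∀ e a b, (g a)ᴴ * f e * g b ∈ S) {c : Matrix J J A} (hc : c ∈ starGen f) (a b : G) :
    (g a)ᴴ * c * g b ∈ S := by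
  induction hc using Subsemiring.closure_induction generalizing a b with
  | mem z hz =>
    rcases hz with ⟨e, rfl⟩ | ⟨e, rfl⟩
    · exact hf e a b
    · have := hS _ (hf e b a)
      simpa [star_eq_conjTranspose, Matrix.mul_assoc] using this
  | zero => simp
  | one => simpa using hg a b
  | add x y _ _ hx hy =>
    rw [Matrix.mul_add, Matrix.add_mul]
    exact add_mem (hx a b) (hy a b)
  | mul x y _ _ hx hy =>
    have : (g a)ᴴ * (x * y) * g b = ∑ l, ((g a)ᴴ * x * g l) * ((g l)ᴴ * y * g b) := by
      calc _ = (g a)ᴴ * x * (∑ l, g l * (g l)ᴴ) * (y * g b) := by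
            rw [hsum]; simp only [Matrix.mul_assoc, Matrix.mul_one]
        _ = _ := by
            rw [Matrix.mul_sum, Matrix.sum_mul]
            simp only [Matrix.mul_assoc]
    rw [this]
    exact sum_mem fun l _ => mul_mem (hx a l) (hy l b)

/-- If all edges lead to the last vertex, then the loops there generate the last corner. -/
theorem exists_generators_of_presentsThree
    {P : Subsemiring (Matrix (Fin 2 ⊕ Fin d) (Fin 2 ⊕ Fin d) A)} {r : ℕ} {e f k : ℤ}
    (hk : k + 1 = r) (h : PresentsThree (vertexProj A d) P (-1) 0 e 0 (-1) f 0 0 k) :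
    ∃ Y : Fin r → Matrix (Fin d) (Fin d) A,
      (∀ s t, star (Y s) * Y t = if s = t then 1 else 0) ∧ (∑ s, Y s * star (Y s) = 1) ∧
      (∀ s, ∃ c ∈ P, Y s = (lastIsometry A d)ᴴ * c * lastIsometry A d) ∧
      ∀ c ∈ P, (lastIsometry A d)ᴴ * c * lastIsometry A d ∈ starGen Y := by
  classical
  obtain ⟨E, _, t, f, hf, rfl, hB⟩ := h
  set V := lastIsometry A d
  have hV : Vᴴ * V = 1 := conjTranspose_lastIsometry_mul
  have hV' : V * Vᴴ = vertexProj A d 2 := lastIsometry_mul_conjTranspose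
  -- The first two columns of the adjacency matrix vanish, since the entries `-1` are on the
  -- diagonal.
  have ht (e : E) : (t e).2 = 2 := by
    have h1 := hB (t e).1 (t e).2
    have h2 : Nat.card {e' // t e' = ((t e).1, (t e).2)} ≠ 0 :=
      Nat.card_ne_zero.2 ⟨⟨⟨e, rfl⟩⟩, inferInstance⟩
    generalize (t e).1 = i at h1 h2
    generalize (t e).2 = j at h1 h2 ⊢
    fin_cases i <;> fin_cases j <;> first | rfl | (simp at h1 h2; omega)
  have hfV (e : E) : f e * V * Vᴴ = f e := by
    rw [Matrix.mul_assoc, hV', ← ht e]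
    exact hf.mul_right e
  have hff (e e' : E) (hne : e ≠ e') : (f e)ᴴ * f e' = 0 := hf.star_mul_of_ne e e' hne
  have hff' (e : E) : (f e)ᴴ * f e = V * Vᴴ := by
    rw [hV', ← ht e]
    exact hf.star_mul_self e
  have hVf (e : E) (he : (t e).1 = 2) : V * Vᴴ * f e = f e := by
    rw [hV', ← he]
    exact hf.left_mul e
  have hVf' (e : E) (he : (t e).1 ≠ 2) : Vᴴ * f e = 0 := by
    have h1 : Vᴴ = Vᴴ * vertexProj A d 2 := by
      rw [← hV', ← Matrix.mul_assoc, hV, Matrix.one_mul]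
    rw [h1, ← hf.left_mul e, Matrix.mul_assoc, ← Matrix.mul_assoc (vertexProj A d 2)]
    have := vertexProj_mul_of_ne (A := A) (d := d) he.symm
    rw [this]
    simp
  obtain ⟨g⟩ : Nonempty (Fin r ≃ {e : E // (t e).1 = 2}) := by
    refine Finite.card_eq.1 ?_
    have h1 := hB 2 2
    have : Nat.card {e // t e = (2, 2)} = Nat.card {e // (t e).1 = 2} :=
      Nat.card_congr (Equiv.subtypeEquivRight fun e => by simp [Prod.ext_iff, ht e])
    rw [this] at h1
    simp at h1
    simp
    omega
  have hE (e : E) : Vᴴ * (f e)ᴴ * f e * V = 1 := by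
    rw [Matrix.mul_assoc Vᴴ, hff', ← Matrix.mul_assoc, hV, Matrix.one_mul, hV]
  refine ⟨fun s => Vᴴ * f (g s) * V, fun s s' => ?_, ?_, fun s => ⟨_, mem_starGen _, rfl⟩, ?_⟩
  · have : star (Vᴴ * f (g s) * V) * (Vᴴ * f (g s') * V) =
        Vᴴ * ((f (g s))ᴴ * f (g s')) * V := by
      rw [star_eq_conjTranspose]
      simp only [conjTranspose_mul, conjTranspose_conjTranspose]
      conv_rhs => rw [← hVf _ (g s').2]
      simp only [Matrix.mul_assoc]
    rw [this]
    split_ifs with h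
    · rw [h, ← Matrix.mul_assoc, hE]
    · rw [hff _ _ fun h' => h (g.injective (Subtype.ext h'))]
      simp
  · have (s : Fin r) : Vᴴ * f (g s) * V * star (Vᴴ * f (g s) * V) =
        Vᴴ * (f (g s) * (f (g s))ᴴ) * V := by
      rw [star_eq_conjTranspose]
      conv_rhs => rw [← Matrix.mul_assoc, ← hfV (g s)]
      simp only [hfV, conjTranspose_mul, conjTranspose_conjTranspose]
      simp only [← Matrix.mul_assoc]
      rw [Matrix.mul_assoc _ (f (g s)) V, Matrix.mul_assoc _ (f (g s) * V), hfV]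
    simp only [this]
    rw [← Matrix.sum_mul, ← Matrix.mul_sum, g.sum_comp fun e => f e * (f e)ᴴ]
    have h2 := hf.sum_mul_star 2
    rw [IsFamily.sum_edges] at h2
    simp only [star_eq_conjTranspose] at h2
    rw [h2, ← hV', ← Matrix.mul_assoc, hV, Matrix.one_mul, hV]
  -- Isometries with orthogonal ranges that add up to 1: the edges from the other vertices fill `p 0
  -- + p 1`, and `V` fills `p 2`.
  · let γ : {e : E // (t e).1 ≠ 2} ⊕ Unit → Matrix (Fin 2 ⊕ Fin d) (Fin d) A :=
      Sum.elim (fun e => f e * V) fun _ => V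
    intro c hc
    have hγ (a b) : (γ a)ᴴ * γ b = if a = b then 1 else 0 := by
      rcases a with a | a <;> rcases b with b | b
      · simp only [γ, Sum.elim_inl, conjTranspose_mul]
        rw [← Matrix.mul_assoc, Matrix.mul_assoc Vᴴ]
        by_cases hab : a = b
        · rw [hab, ← Matrix.mul_assoc, hE]; simp
        · rw [hff _ _ fun h' => hab (Subtype.ext h')]; simp [hab]
      · have := congrArg conjTranspose (hVf' a a.2)
        simp only [conjTranspose_mul, conjTranspose_conjTranspose, conjTranspose_zero] at this
        simp [γ, Matrix.mul_assoc, this]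
      · simp [γ, ← Matrix.mul_assoc, hVf' b b.2]
      · simp [γ, hV]
    refine compression_mem_of_mem_starGen (g := γ) (fun _ => star_mem_starGen) (fun a b => ?_) ?_
      (fun e a b => ?_) hc (.inr ()) (.inr ())
    · rw [hγ]
      split_ifs
      · exact one_mem _
      · exact zero_mem _
    · have h1 : ∑ e : {e : E // (t e).1 ≠ 2}, f e * (f e)ᴴ =
          vertexProj A d 0 + vertexProj A d 1 := by
        rw [← hf.sum_mul_star 0, ← hf.sum_mul_star 1, ← sum_add_distrib,
          ← sum_subtype (univ.filter fun e => (t e).1 ≠ 2) (by simp) fun e => f e * (f e)ᴴ,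
          sum_filter]
        refine sum_congr rfl fun e _ => ?_
        rw [star_eq_conjTranspose]
        generalize (t e).1 = i
        fin_cases i <;> simp
      have h2 (e : E) : f e * V * (f e * V)ᴴ = f e * (f e)ᴴ := by
        rw [conjTranspose_mul, ← Matrix.mul_assoc, hfV]
      rw [Fintype.sum_sum_type]
      simp only [γ, Sum.elim_inl, Sum.elim_inr, h2, h1, hV', univ_unique, sum_singleton]
      rw [← Fin.sum_univ_three]
      exact sum_vertexProj
    -- A loop compresses to some `Y s` or to 0. Any other edge is `γ e` times the adjoint of `V`, so
    -- its compressions are 0 or 1.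
    · by_cases he : (t e).1 = 2
      · have : f e = γ (.inr ()) * (Vᴴ * f e * V) * (γ (.inr ()))ᴴ := by
          simp only [γ, Sum.elim_inr]
          conv_lhs => rw [← hVf e he, ← hfV e]
          simp only [Matrix.mul_assoc]
        have h1 : (γ a)ᴴ * f e * γ b =
            ((γ a)ᴴ * γ (.inr ())) * (Vᴴ * f e * V) * ((γ (.inr ()))ᴴ * γ b) := by
          conv_lhs => rw [this]
          simp only [Matrix.mul_assoc]
        rw [h1, hγ, hγ]
        have h2 : Vᴴ * f e * V ∈ starGen fun s => Vᴴ * f (g s) * V := by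
          simpa using mem_starGen (f := fun s => Vᴴ * f (g s) * V) (g.symm ⟨e, he⟩)
        exact mul_mem (mul_mem (by split_ifs <;> simp) h2) (by split_ifs <;> simp)
      · have h1 : (γ a)ᴴ * f e * γ b =
            ((γ a)ᴴ * γ (.inl ⟨e, he⟩)) * ((γ (.inr ()))ᴴ * γ b) := by
          conv_lhs => rw [← hfV e]
          simp only [γ, Sum.elim_inr, Sum.elim_inl, Matrix.mul_assoc]
        rw [h1, hγ, hγ]
        exact mul_mem (by split_ifs <;> simp) (by split_ifs <;> simp)

end corner

/-! ### The initial graph and the positive cone -/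

/-- The matrices with nonnegative entries. -/
def nonnegMatrix (J : Type*) [Fintype J] [DecidableEq J] (r : ℕ) :
    Subsemiring (Matrix J J (Leavitt r)) where
  carrier := {a | ∀ i j, 0 ≤ a i j}
  mul_mem' {a b} ha hb i j := by
    rw [mul_apply]
    exact sum_nonneg fun k _ => mul_nonneg (ha i k) (hb k j)
  one_mem' i j := by
    rw [one_apply]
    split_ifs
    · exact zero_le_one
    · exact le_rfl
  add_mem' ha hb i j := add_nonneg (ha i j) (hb i j)
  zero_mem' _ _ := le_rfl

theorem x_nonneg {r : ℕ} (s : Fin r) : 0 ≤ (x s : Leavitt r) :=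
  nonneg_iff.2 (AddSubmonoid.subset_closure (Submonoid.subset_closure (.inl ⟨s, rfl⟩)))

theorem y_nonneg {r : ℕ} (s : Fin r) : 0 ≤ (y s : Leavitt r) :=
  nonneg_iff.2 (AddSubmonoid.subset_closure (Submonoid.subset_closure (.inr ⟨s, rfl⟩)))

/-- An additive and multiplicative property of the generators holds for all nonnegative
elements. -/
theorem nonneg_induction {r : ℕ} {Q : Leavitt r → Prop} (h0 : Q 0) (h1 : Q 1) (hx : ∀ s, Q (x s))
    (hy : ∀ s, Q (y s)) (hmul : ∀ a b, Q a → Q b → Q (a * b))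
    (hadd : ∀ a b, Q a → Q b → Q (a + b)) {a : Leavitt r} (ha : 0 ≤ a) : Q a := by
  rw [nonneg_iff] at ha
  induction ha using AddSubmonoid.closure_induction with
  | mem a ha =>
    induction ha using Submonoid.closure_induction with
    | mem z hz =>
      rcases hz with ⟨s, rfl⟩ | ⟨s, rfl⟩
      · exact hx s
      · exact hy s
    | one => exact h1
    | mul a b _ _ ha hb => exact hmul a b ha hb
  | zero => exact h0
  | add a b _ _ ha hb => exact hadd a b ha hb

variable {r d : ℕ}

theorem single_mem_nonnegMatrix {J : Type*} [Fintype J] [DecidableEq J] (i j : J) {a : Leavitt r}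
    (ha : 0 ≤ a) : single i j a ∈ nonnegMatrix J r := fun k l => by
  rw [single_apply]
  split_ifs
  · exact ha
  · exact le_rfl

theorem star_mem_nonnegMatrix {J : Type*} [Fintype J] [DecidableEq J]
    {a : Matrix J J (Leavitt r)} (ha : a ∈ nonnegMatrix J r) : star a ∈ nonnegMatrix J r :=
  fun i j => star_nonneg_of_nonneg (ha j i)

theorem starGen_le_nonnegMatrix {J E : Type*} [Fintype J] [DecidableEq J]
    {f : E → Matrix J J (Leavitt r)} (h : ∀ e, f e ∈ nonnegMatrix J r) :
    starGen f ≤ nonnegMatrix J r := by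
  refine Subsemiring.closure_le.2 ?_
  rintro _ (⟨e, rfl⟩ | ⟨e, rfl⟩)
  · exact h e
  · exact star_mem_nonnegMatrix (h e)

/-- The graph with `r` loops at the first vertex, and one and `d` edges from the other two vertices
to the first. -/
def startGraph (r d : ℕ) : Fin r ⊕ Unit ⊕ Fin d → Fin 3 × Fin 3 :=
  Sum.elim (fun _ => (0, 0)) (Sum.elim (fun _ => (1, 0)) fun _ => (2, 0))

/-- The row of the matrix unit that represents an edge of `startGraph`. -/
def startRow (r d : ℕ) : Fin r ⊕ Unit ⊕ Fin d → Fin 2 ⊕ Fin d :=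
  Sum.elim (fun _ => .inl 0) (Sum.elim (fun _ => .inl 1) Sum.inr)

/-- The coefficient of the matrix unit that represents an edge of `startGraph`. -/
noncomputable def startCoeff (r d : ℕ) : Fin r ⊕ Unit ⊕ Fin d → Leavitt r :=
  Sum.elim y fun _ => 1

/-- The Cuntz–Krieger family for `startGraph`. -/
noncomputable def startFamily (r d : ℕ) (e : Fin r ⊕ Unit ⊕ Fin d) :
    Matrix (Fin 2 ⊕ Fin d) (Fin 2 ⊕ Fin d) (Leavitt r) :=
  single (startRow r d e) (.inl 0) (startCoeff r d e)

theorem star_startFamily (e : Fin r ⊕ Unit ⊕ Fin d) :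
    star (startFamily r d e) = single (.inl 0) (startRow r d e) (star (startCoeff r d e)) := by
  rw [startFamily, star_eq_conjTranspose, conjTranspose_single]

theorem startFamily_mul_star (e : Fin r ⊕ Unit ⊕ Fin d) :
    startFamily r d e * star (startFamily r d e) =
      single (startRow r d e) (startRow r d e) (startCoeff r d e * star (startCoeff r d e)) := by
  rw [star_startFamily, startFamily, single_mul_single_same]

theorem vertexProj_zero {A : Type*} [Ring A] : vertexProj A d 0 = single (.inl 0) (.inl 0) 1 := by
  rw [vertexProj, ← diagonal_single]
  congr 1
  ext (a | a)
  · fin_cases a <;> simp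
  · simp

theorem vertexProj_one {A : Type*} [Ring A] : vertexProj A d 1 = single (.inl 1) (.inl 1) 1 := by
  rw [vertexProj, ← diagonal_single]
  congr 1
  ext (a | a)
  · fin_cases a <;> simp
  · simp

theorem vertexProj_two {A : Type*} [Ring A] :
    vertexProj A d 2 = ∑ l, single (.inr l) (.inr l) 1 := by
  simp only [← diagonal_single]
  ext a b
  rw [Matrix.sum_apply]
  by_cases hab : a = b
  · subst hab
    rcases a with a | a
    · fin_cases a <;> simp [vertexProj]
    · simp [vertexProj, Pi.single_apply]
  · simp [vertexProj, hab]

theorem isFamily_startFamily :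
    IsFamily (vertexProj (Leavitt r) d) (startGraph r d) (startFamily r d) where
  star_mul_self e := by
    have : (startGraph r d e).2 = 0 := by rcases e with e | e | e <;> rfl
    rw [this, vertexProj_zero, star_startFamily, startFamily, single_mul_single_same]
    congr 1
    rcases e with e | e | e
    · simp [startCoeff, star_y, x_mul_y]
    · simp [startCoeff]
    · simp [startCoeff]
  star_mul_of_ne e e' hne := by
    rw [star_startFamily, startFamily]
    by_cases h : startRow r d e = startRow r d e'
    · rw [h, single_mul_single_same]
      rcases e with e | e | e <;> rcases e' with e' | e' | e' <;>
        simp_all [startRow, startCoeff, star_y, x_mul_y]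
    · exact single_mul_single_of_ne _ _ _ _ h _
  sum_mul_star i := by
    simp only [startFamily_mul_star, Fintype.sum_sum_type]
    fin_cases i
    · simp only [startGraph, startRow, startCoeff, Sum.elim_inl, Sum.elim_inr, star_y]
      have := (map_sum (singleAddMonoidHom (.inl 0 : Fin 2 ⊕ Fin d) (.inl 0 : Fin 2 ⊕ Fin d))
        (fun s : Fin r => (y s * x s : Leavitt r)) univ).symm
      rw [sum_y_mul_x] at this
      simpa [vertexProj_zero] using this
    · simp [startGraph, startRow, startCoeff, vertexProj_one]
    · simp [startGraph, startRow, startCoeff, vertexProj_two]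
  left_mul e := by
    rcases e with e | e | e
    · simp [startGraph, startFamily, startRow, vertexProj_zero]
    · simp [startGraph, startFamily, startRow, vertexProj_one]
    · simp only [startGraph, startFamily, startRow, vertexProj_two, Sum.elim_inr, Finset.sum_mul]
      rw [sum_eq_single e]
      · simp
      · intro l _ hl
        exact single_mul_single_of_ne _ _ _ _ (by simpa using hl) _
      · simp

/-- The loops and their adjoints are the `y s` and `x s` placed in the first corner, and these
generate the cone of the Leavitt ring. -/
theorem single_mem_starGen_startFamily {a : Leavitt r} (ha : 0 ≤ a) :
    single (.inl 0) (.inl 0) a ∈ starGen (startFamily r d) := by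
  refine nonneg_induction
    (Q := fun a => single (.inl 0) (.inl 0) a ∈ starGen (startFamily r d)) ?_ ?_ (fun s => ?_)
    (fun s => ?_) (fun a b ha hb => ?_) (fun a b ha hb => ?_) ha
  · simp
  · have := (isFamily_startFamily (r := r) (d := d)).sum_mul_star 0
    rw [← vertexProj_zero, ← this]
    refine sum_mem fun e _ => ?_
    split_ifs
    · exact mul_mem (mem_starGen e) (star_mem_starGen (mem_starGen e))
    · exact zero_mem _
  · have := star_mem_starGen (mem_starGen (f := startFamily r d) (.inl s))
    rw [star_startFamily] at this
    simpa [startRow, startCoeff, star_y] using this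
  · exact mem_starGen (f := startFamily r d) (.inl s)
  · simpa using mul_mem ha hb
  · rw [single_add]
    exact add_mem ha hb

/-- The edges from the other vertices are matrix units in the first column, which carry entries of
the first corner to any position. -/
theorem starGen_startFamily : starGen (startFamily r d) = nonnegMatrix (Fin 2 ⊕ Fin d) r := by
  refine le_antisymm (starGen_le_nonnegMatrix fun e => single_mem_nonnegMatrix _ _ ?_) ?_
  · rcases e with e | e
    · exact y_nonneg e
    · exact zero_le_one
  have h1 (i) : single i (.inl 0) (1 : Leavitt r) ∈ starGen (startFamily r d) := by
    rcases i with i | i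
    · fin_cases i
      · exact single_mem_starGen_startFamily zero_le_one
      · exact mem_starGen (f := startFamily r d) (.inr (.inl ()))
    · exact mem_starGen (f := startFamily r d) (.inr (.inr i))
  intro a ha
  rw [matrix_eq_sum_single a]
  refine sum_mem fun i _ => sum_mem fun j _ => ?_
  have : single i j (a i j) = single i (.inl 0) 1 * single (.inl 0) (.inl 0) (a i j) *
      star (single j (.inl 0) (1 : Leavitt r)) := by
    simp [star_eq_conjTranspose]
  rw [this]
  exact mul_mem (mul_mem (h1 i) (single_mem_starGen_startFamily (ha i j)))
    (star_mem_starGen (h1 j))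

theorem presentsThree_start {k : ℤ} (hk : k + 1 = r) :
    PresentsThree (vertexProj (Leavitt r) d) (nonnegMatrix (Fin 2 ⊕ Fin d) r)
      k 0 0 1 (-1) 0 d 0 (-1) := by
  refine ⟨_, _, startGraph r d, startFamily r d, isFamily_startFamily, starGen_startFamily,
    fun i j => ?_⟩
  rw [startGraph, card_fiber_sum, card_fiber_sum, card_fiber_const, card_fiber_const,
    card_fiber_const]
  fin_cases i <;> fin_cases j <;> simp [hk]

/-! ### Injectivity of homomorphisms from the Leavitt ring -/

section uniqueness

variable {r : ℕ}

/-- The monomial in the `y_s` with indices `u`. -/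
noncomputable def yWord (u : List (Fin r)) : Leavitt r := (u.map y).prod

@[simp]
theorem yWord_nil : yWord ([] : List (Fin r)) = 1 := rfl

theorem yWord_cons (s : Fin r) (u : List (Fin r)) : yWord (s :: u) = y s * yWord u := by
  simp [yWord]

theorem yWord_append (u v : List (Fin r)) : yWord (u ++ v) = yWord u * yWord v := by
  simp [yWord]

theorem star_yWord_mul_self (u : List (Fin r)) : star (yWord u) * yWord u = 1 := by
  induction u with
  | nil => simp
  | cons s u ih =>
    rw [yWord_cons, star_mul, star_y, mul_assoc, ← mul_assoc (x s), x_mul_y, if_pos rfl, one_mul,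
      ih]

theorem star_yWord_mul_of_not_prefix {u v : List (Fin r)} (hlen : u.length ≤ v.length)
    (h : ¬ u <+: v) : star (yWord u) * yWord v = 0 := by
  induction u generalizing v with
  | nil => exact absurd List.nil_prefix h
  | cons s u ih =>
    cases v with
    | nil => simp at hlen
    | cons t v =>
      rw [yWord_cons, yWord_cons, star_mul, star_y, mul_assoc, ← mul_assoc (x s), x_mul_y]
      by_cases hst : s = t
      · subst hst
        rw [if_pos rfl, one_mul]
        exact ih (by simpa using hlen) fun h' => h (List.cons_prefix_cons.2 ⟨rfl, h'⟩)
      · simp [hst]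

/-- The additive group spanned by the monomials in the `y_s`. -/
noncomputable def ySpan (r : ℕ) : AddSubgroup (Leavitt r) :=
  AddSubgroup.closure (Set.range yWord)

theorem yWord_mem_ySpan (u : List (Fin r)) : yWord u ∈ ySpan r :=
  AddSubgroup.subset_closure ⟨u, rfl⟩

/-- Enough letters `y` on the right cancel every `x`. -/
theorem exists_mul_yWord_mem_ySpan (a : Leavitt r) :
    ∃ k, ∀ v : List (Fin r), k ≤ v.length → a * yWord v ∈ ySpan r := by
  induction a using induction with
  | hz n =>
    refine ⟨0, fun v _ => ?_⟩
    rw [← zsmul_eq_mul]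
    exact zsmul_mem (yWord_mem_ySpan v) n
  | hx s =>
    refine ⟨1, fun v hv => ?_⟩
    cases v with
    | nil => simp at hv
    | cons t v =>
      rw [yWord_cons, ← mul_assoc, x_mul_y]
      split_ifs
      · rw [one_mul]; exact yWord_mem_ySpan v
      · rw [zero_mul]; exact zero_mem _
  | hy s =>
    refine ⟨0, fun v _ => ?_⟩
    rw [← yWord_cons]
    exact yWord_mem_ySpan _
  | hmul a b ha hb =>
    obtain ⟨k, hk⟩ := ha
    obtain ⟨l, hl⟩ := hb
    refine ⟨l + k, fun v hv => ?_⟩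
    -- The first `l` letters absorb `b`; the remaining ones, at least `k`, end every resulting word
    -- and let `a` be absorbed.
    rw [← List.take_append_drop l v, yWord_append, mul_assoc, ← mul_assoc b]
    have hb := hl (v.take l) (by rw [List.length_take]; omega)
    have hw : k ≤ (v.drop l).length := by rw [List.length_drop]; omega
    generalize b * yWord (v.take l) = c at hb
    induction hb using AddSubgroup.closure_induction with
    | mem c hc =>
      obtain ⟨u, rfl⟩ := hc
      rw [← yWord_append]
      exact hk _ (by rw [List.length_append]; omega)
    | zero => simp
    | add c c' _ _ h h' => rw [add_mul, mul_add]; exact add_mem h h'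
    | neg c _ h => rw [neg_mul, mul_neg]; exact neg_mem h
  | hadd a b ha hb =>
    obtain ⟨k, hk⟩ := ha
    obtain ⟨l, hl⟩ := hb
    refine ⟨k + l, fun v hv => ?_⟩
    rw [add_mul]
    exact add_mem (hk v (by omega)) (hl v (by omega))

/-- Iterating `∑ s, y s * x s = 1` recovers `a` from these products. -/
theorem eq_zero_of_mul_yWord_eq_zero {k : ℕ} {a : Leavitt r}
    (h : ∀ v : List (Fin r), v.length = k → a * yWord v = 0) : a = 0 := by
  induction k generalizing a with
  | zero => simpa using h [] rfl
  | succ k ih =>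
    rw [← mul_one a, ← sum_y_mul_x, mul_sum]
    refine sum_eq_zero fun s _ => ?_
    rw [← mul_assoc, ih (a := a * y s) fun v hv => ?_, zero_mul]
    rw [mul_assoc, ← yWord_cons]
    exact h _ (by simp [hv])

/-- An aperiodic word separates distinct prefixes. -/
theorem eq_of_append_prefix_append {α : Type*} {a b : α} (hab : a ≠ b) {n : ℕ} {u v : List α}
    (hlen : u.length ≤ v.length) (hn : v.length ≤ n)
    (h : u ++ (List.replicate n a ++ [b]) <+: v ++ (List.replicate n a ++ [b])) : u = v := by
  obtain ⟨w, rfl⟩ : u <+: v :=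
    List.prefix_of_prefix_length_le ((List.prefix_append _ _).trans h) (List.prefix_append _ _) hlen
  rw [List.append_assoc, List.prefix_append_right_inj] at h
  obtain ⟨t, ht⟩ := h
  rcases Nat.eq_zero_or_pos w.length with hw | hw
  · simp [List.length_eq_zero_iff.1 hw]
  · have h1 := congrArg (fun l => l[n]?) ht
    rw [List.length_append] at hn
    have h2 : n - w.length < n := by omega
    simp [List.getElem?_append, show ¬ n < w.length by omega, h2] at h1
    exact absurd h1.symm hab

theorem eq_zero_of_mem_ySpan_of_map_eq_zero (hr : 2 ≤ r) {B : Type*} [Ring B] {φ : Leavitt r →+* B}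
    (hφ : ∀ n : ℤ, φ n = 0 → n = 0) {b : Leavitt r} (hb : b ∈ ySpan r) (h0 : φ b = 0) : b = 0 := by
  obtain ⟨c, rfl⟩ : ∃ c : List (Fin r) →₀ ℤ, c.sum (fun u n => n • yWord u) = b := by
    rw [ySpan, ← Submodule.span_int_eq_addSubgroupClosure] at hb
    exact Finsupp.mem_span_range_iff_exists_finsupp.1 hb
  by_cases hc : c.support.Nonempty
  · exfalso
    -- With `u` shortest in the support and `w` aperiodic, multiplying by the adjoint of the word `u
    -- ++ w` on the left and by the word `w` on the right kills all terms but that of `u` and leaves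
    -- its integer coefficient, which `φ` would have to kill.
    obtain ⟨u, hu, hmin⟩ := c.support.exists_min_image List.length hc
    let n := c.support.sup List.length
    let w : List (Fin r) := List.replicate n ⟨0, by omega⟩ ++ [⟨1, by omega⟩]
    have key : star (yWord (u ++ w)) * c.sum (fun u n => n • yWord u) * yWord w =
        ((c u : ℤ) : Leavitt r) := by
      rw [Finsupp.sum, mul_sum, sum_mul, sum_eq_single u]
      · rw [mul_smul_comm, smul_mul_assoc, mul_assoc, ← yWord_append, star_yWord_mul_self]
        simp
      · intro v hv hvu
        rw [mul_smul_comm, smul_mul_assoc, mul_assoc, ← yWord_append,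
          star_yWord_mul_of_not_prefix, smul_zero]
        · simpa using hmin v hv
        · intro h
          exact hvu (eq_of_append_prefix_append (by simp) (hmin v hv)
            (le_sup (f := List.length) hv) h).symm
      · exact fun h => absurd hu h
    have := congrArg φ key
    rw [map_mul, map_mul, h0, mul_zero, zero_mul] at this
    exact Finsupp.mem_support_iff.1 hu (hφ _ this.symm)
  · rw [not_nonempty_iff_eq_empty, Finsupp.support_eq_empty] at hc
    simp [hc]

/-- A homomorphism from a Leavitt ring which is injective on the integers is injective. -/
theorem injective_of_forall_int (hr : 2 ≤ r) {B : Type*} [Ring B] {φ : Leavitt r →+* B}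
    (hφ : ∀ n : ℤ, φ n = 0 → n = 0) : Function.Injective φ := by
  refine (injective_iff_map_eq_zero φ).2 fun a ha => ?_
  obtain ⟨k, hk⟩ := exists_mul_yWord_mem_ySpan a
  refine eq_zero_of_mul_yWord_eq_zero (k := k) fun v hv => ?_
  exact eq_zero_of_mem_ySpan_of_map_eq_zero hr hφ (hk v hv.ge) (by rw [map_mul, ha, zero_mul])

theorem int_eq_zero_of_cast_eq_zero [NeZero r] {n : ℤ} (h : (n : Leavitt r) = 0) : n = 0 := by
  have h1 := congrArg (fun a => rep r a 1 0) h
  simpa using h1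

end uniqueness

/-! ### Generators of the matrix ring and the isomorphism -/

theorem exists_sub_nonneg {r : ℕ} (a : Leavitt r) : ∃ b c : Leavitt r, 0 ≤ b ∧ 0 ≤ c ∧ a = b - c := by
  induction a using induction with
  | hz n =>
    have h (l : ℕ) : 0 ≤ (l : Leavitt r) := by
      induction l with
      | zero => simp
      | succ l ih => rw [Nat.cast_succ]; exact add_nonneg ih zero_le_one
    refine ⟨n.toNat, (-n).toNat, h _, h _, ?_⟩
    conv_lhs => rw [show n = (n.toNat : ℤ) - ((-n).toNat : ℤ) by omega]
    rw [Int.cast_sub, Int.cast_natCast, Int.cast_natCast]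
  | hx s => exact ⟨x s, 0, x_nonneg s, le_rfl, by simp⟩
  | hy s => exact ⟨y s, 0, y_nonneg s, le_rfl, by simp⟩
  | hmul a b ha hb =>
    obtain ⟨p, q, hp, hq, rfl⟩ := ha
    obtain ⟨p', q', hp', hq', rfl⟩ := hb
    exact ⟨p * p' + q * q', p * q' + q * p', add_nonneg (mul_nonneg hp hp') (mul_nonneg hq hq'),
      add_nonneg (mul_nonneg hp hq') (mul_nonneg hq hp'), by noncomm_ring⟩
  | hadd a b ha hb =>
    obtain ⟨p, q, hp, hq, rfl⟩ := ha
    obtain ⟨p', q', hp', hq', rfl⟩ := hb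
    exact ⟨p + p', q + q', add_nonneg hp hp', add_nonneg hq hq', by abel⟩

theorem conjTranspose_lastIsometry_mul_mul {A : Type*} [Ring A] [StarRing A] {d : ℕ}
    (c : Matrix (Fin 2 ⊕ Fin d) (Fin 2 ⊕ Fin d) A) :
    (lastIsometry A d)ᴴ * c * lastIsometry A d = c.toBlocks₂₂ := by
  conv_lhs => rw [← fromBlocks_toBlocks c]
  rw [lastIsometry, conjTranspose_fromRows_eq_fromCols_conjTranspose, fromCols_mul_fromBlocks,
    fromCols_mul_fromRows]
  simp

/-- The matrix ring contains a Leavitt family which generates its positive cone. -/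
theorem exists_matrix_generators {r d : ℕ} (hr : 3 ≤ r) (hd : 1 ≤ d)
    (hgcd : Nat.gcd d (r - 1) = 1) :
    ∃ Y : Fin r → Matrix (Fin d) (Fin d) (Leavitt r),
      (∀ s t, star (Y s) * Y t = if s = t then 1 else 0) ∧ (∑ s, Y s * star (Y s) = 1) ∧
      starGen Y = nonnegMatrix (Fin d) r := by
  obtain ⟨k, rfl⟩ : ∃ k, r = k + 1 := ⟨r - 1, by omega⟩
  -- `e` is the inverse of `d` modulo `k`; this form of the inverse needs `k ≥ 2`, that is `r ≥ 3`.
  obtain ⟨e, hek, he⟩ := Nat.exists_mul_mod_eq_one_of_coprime hgcd (by omega)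
  rw [Nat.add_sub_cancel] at hek he
  have hde := Nat.div_add_mod (d * e) k
  rw [he] at hde
  generalize d * e / k = j at hde
  have he0 : 1 ≤ e := Nat.pos_of_ne_zero (by rintro rfl; simp at he)
  obtain ⟨f, hf⟩ := presentsThree_of_start (k := k) (d := d) (e := e) (j := j)
    (by omega) (by omega) (by omega) (by omega) (by
      rw [← Nat.cast_mul, ← hde]; push_cast; ring)
    (presentsThree_start (r := k + 1) (d := d) (k := k) (by simp))
  obtain ⟨Y, h1, h2, h3, h4⟩ := exists_generators_of_presentsThree (r := k + 1) (by simp) hf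
  refine ⟨Y, h1, h2, le_antisymm (starGen_le_nonnegMatrix fun s => ?_) fun a ha => ?_⟩
  · obtain ⟨c, hc, hY⟩ := h3 s
    rw [hY, conjTranspose_lastIsometry_mul_mul]
    exact fun i j => hc (.inr i) (.inr j)
  · have := h4 (fromBlocks 0 0 0 a) (by
      rintro (i | i) (j | j)
      · exact le_rfl
      · exact le_rfl
      · exact le_rfl
      · exact ha i j)
    rwa [conjTranspose_lastIsometry_mul_mul, toBlocks_fromBlocks₂₂] at this

end Leavitt

open Leavitt in
/-- For `r ≥ 3`, `m ≥ r + 1` and `gcd(m, r - 1) = 1`, there is an isomorphism of rings from the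
Leavitt ring `𝕃_r` to the ring of `m × m` matrices over it which commutes with the involutions
(conjugate transpose on matrices) and preserves and reflects the partial orders. -/
theorem mainTheorem4 (r m : ℕ) (hr : 3 ≤ r) (hm : r + 1 ≤ m) (hgcd : Nat.gcd m (r - 1) = 1) :
    ∃ φ : Leavitt r ≃+* Matrix (Fin m) (Fin m) (Leavitt r),
      (∀ a, φ (star a) = star (φ a)) ∧ (∀ a b, φ a ≤ φ b ↔ a ≤ b) := by
  have : NeZero r := ⟨by omega⟩
  have : NeZero m := ⟨by omega⟩
  obtain ⟨Y, h1, h2, h3⟩ := exists_matrix_generators hr (by omega) hgcd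
  let φ : Leavitt r →+* Matrix (Fin m) (Fin m) (Leavitt r) :=
    Leavitt.lift (fun z => match z with
      | Gen.x s => star (Y s)
      | Gen.y s => Y s) h1 h2
  have hx (s : Fin r) : φ (x s) = star (Y s) := lift_x _ _ _ s
  have hy (s : Fin r) : φ (y s) = Y s := lift_y _ _ _ s
  have hinj : Function.Injective φ := injective_of_forall_int (by omega) fun n hn => by
    rw [map_intCast] at hn
    have := congrFun (congrFun hn 0) 0
    rw [Matrix.intCast_apply] at this
    exact int_eq_zero_of_cast_eq_zero (r := r) (by simpa using this)
  have hpos {a : Leavitt r} (ha : 0 ≤ a) : φ a ∈ nonnegMatrix (Fin m) r := by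
    rw [← h3]
    refine nonneg_induction (Q := fun a => φ a ∈ starGen Y) (by simp) (by simp) (fun s => ?_)
      (fun s => ?_) (fun a b ha hb => ?_) (fun a b ha hb => ?_) ha
    · rw [hx]; exact star_mem_starGen (mem_starGen s)
    · rw [hy]; exact mem_starGen s
    · rw [map_mul]; exact mul_mem ha hb
    · rw [map_add]; exact add_mem ha hb
  have hlift {c : Matrix (Fin m) (Fin m) (Leavitt r)} (hc : c ∈ nonnegMatrix (Fin m) r) :
      ∃ a, 0 ≤ a ∧ φ a = c := by
    rw [← h3] at hc
    induction hc using Subsemiring.closure_induction with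
    | mem c hc =>
      rcases hc with ⟨s, rfl⟩ | ⟨s, rfl⟩
      · exact ⟨y s, y_nonneg s, hy s⟩
      · exact ⟨x s, x_nonneg s, hx s⟩
    | zero => exact ⟨0, le_rfl, map_zero φ⟩
    | one => exact ⟨1, zero_le_one, map_one φ⟩
    | add c c' _ _ h h' =>
      obtain ⟨a, ha, rfl⟩ := h
      obtain ⟨b, hb, rfl⟩ := h'
      exact ⟨a + b, add_nonneg ha hb, map_add φ a b⟩
    | mul c c' _ _ h h' =>
      obtain ⟨a, ha, rfl⟩ := h
      obtain ⟨b, hb, rfl⟩ := h'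
      exact ⟨a * b, mul_nonneg ha hb, map_mul φ a b⟩
  have hsurj : Function.Surjective φ := fun c => by
    choose p q hp hq hpq using fun i j => exists_sub_nonneg (c i j)
    obtain ⟨a, -, ha⟩ := hlift (c := Matrix.of p) hp
    obtain ⟨b, -, hb⟩ := hlift (c := Matrix.of q) hq
    refine ⟨a - b, ?_⟩
    rw [map_sub, ha, hb]
    ext i j
    simp [hpq]
  refine ⟨RingEquiv.ofBijective φ ⟨hinj, hsurj⟩, fun a => ?_, fun a b => ?_⟩
  · change φ (star a) = star (φ a)
    induction a using Leavitt.induction with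
    | hz n => simp
    | hx s => rw [star_x, hx, hy, star_star]
    | hy s => rw [star_y, hx, hy]
    | hmul a b ha hb => rw [star_mul, map_mul, map_mul, star_mul, ha, hb]
    | hadd a b ha hb => rw [star_add, map_add, map_add, star_add, ha, hb]
  · change φ a ≤ φ b ↔ a ≤ b
    rw [← sub_nonneg, ← sub_nonneg (a := b), ← map_sub, matrix_nonneg_iff, mem_matrixPos_iff]
    refine ⟨fun h => ?_, fun h => hpos h⟩
    -- A nonnegative image has a nonnegative preimage, which by injectivity is the difference
    -- itself.
    obtain ⟨c, hc, hcb⟩ := hlift h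
    rwa [← hinj hcb]
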